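/- Let $(M^n,g)$ be a smooth Riemannian manifold, $f:M\to\mathbb R$ a smooth function and $\kappa\in\mathbb R$ a constant. Let $\nabla$ be the Levi-Civita connection. Use the curvature convention $R_{ijk\ell}=\langle \nabla_{e_j}\nabla_{e_i}e_k-\nabla_{e_i}\nabla_{e_j}e_k+\nabla_{[e_i,e_j]}e_k,\,e_\ell\rangle$ and $\mathrm{Ric}_{ij}=R_{kikj}$ (repeated indices are summed over an orthonormal frame), let $S=\mathrm{Ric}_{kk}$ be the scalar curvature, and write $T_{i_1\dots i_m,j_1\dots j_r}$ for the components of the $r$-th covariant derivative of a tensor $T$, the last index being the direction of the last derivative. Let $\Delta T=T_{\dots,kk}$ be the rough Laplacian. Define the symmetric $2$-tensor $$\phi=\kappa\,g-\mathrm{Ric}-\mathrm{Hess}_f,$$ the drift Laplacian $\mathcal L=\Delta-\nabla_{\nabla f}$ on functions and tensors, and, on $2$-tensors $B$, the operator $(L\,B)_{ij}=(\mathcal L\,B)_{ij}+2\,R_{\ell ikj}\,B_{\ell k}$. Then, at every point and in every orthonormal frame, $$(L\,\mathrm{Ric})_{ij}=2\kappa\,\mathrm{Ric}_{ij}+2\,R_{kjin}\,\phi_{nk}-\phi_{ij,kk}-\phi_{kk,ji}+\phi_{jk,ki}+\phi_{ik,kj},$$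 $$\mathcal L\,S=2\kappa\,S-2\,|\mathrm{Ric}|^2-2\,\mathrm{Ric}_{kn}\,\phi_{nk}-2\,\Delta(\phi_{kk})+2\,\phi_{ik,ki}.$$ -/

import Mathlib

open Bundle Manifold
open scoped ContDiff

namespace RicciDrift

noncomputable section

/-- The model space `ℝⁿ`. -/
abbrev Model (n : ℕ) : Type := EuclideanSpace ℝ (Fin n)

/-! ### Tensor calculus in one coordinate domain of `ℝⁿ` -/

/-- A covariant `k`-tensor field in coordinates: `T x v` is the value at the point with
coordinates `x` on the vectors `v 0, …, v (k-1)` (components with respect to the coordinate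
frame). All the fields formed below from smooth data are multilinear in `v`. -/
abbrev CoordTensor (n k : ℕ) : Type := Model n → (Fin k → Model n) → ℝ

/-- The coordinate vector `∂ᵢ`. -/
def coordVec {n : ℕ} (i : Fin n) : Model n := EuclideanSpace.single i 1

/-- The inverse `g^{ij}` of the matrix `b(∂ᵢ, ∂ⱼ)` of a bilinear form `b`. -/
def invGram {n : ℕ} (b : Model n → Model n → ℝ) : Matrix (Fin n) (Fin n) ℝ :=
  (Matrix.of fun i j => b (coordVec i) (coordVec j))⁻¹

/-- `∂_u (G(v, w))` at `x`, for constant coefficient fields `v`, `w`. -/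
def dirDeriv {n : ℕ} (G : CoordTensor n 2) (x u v w : Model n) : ℝ :=
  fderiv ℝ (fun y => G y ![v, w]) x u

/-- The Christoffel symbols of the metric `G`: `christoffel G x v w` is `∇_v w` at `x` for constant
coefficient fields `v`, `w`, i.e. its `k`-th component is
`½ g^{kl} (∂_v G(w, ∂ₗ) + ∂_w G(v, ∂ₗ) - ∂ₗ G(v, w))`, summed over `l`. -/
def christoffel {n : ℕ} (G : CoordTensor n 2) (x v w : Model n) : Model n :=
  WithLp.toLp 2 fun k => (1 / 2 : ℝ) * ∑ l, invGram (fun a b => G x ![a, b]) k l *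
    (dirDeriv G x v w (coordVec l) + dirDeriv G x w v (coordVec l) - dirDeriv G x (coordVec l) v w)

/-- The covariant derivative of a covariant `k`-tensor field with respect to the Levi-Civita
connection of the metric `G`. The last slot is the direction of differentiation. -/
def coordCovDeriv {n k : ℕ} (G : CoordTensor n 2) (T : CoordTensor n k) : CoordTensor n (k + 1) :=
  fun x v =>
    fderiv ℝ (fun y => T y (Fin.init v)) x (v (Fin.last k)) -
      ∑ s, T x (Function.update (Fin.init v) s
        (christoffel G x (v (Fin.last k)) (v s.castSucc)))

/-- `R(u, v)w = ∇_v ∇_u w - ∇_u ∇_v w + ∇_{[u, v]} w` at `x`, computed with constant coefficient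
fields `u`, `v`, `w` (so that `[u, v] = 0`). -/
def coordCurvOp {n : ℕ} (G : CoordTensor n 2) (x u v w : Model n) : Model n :=
  (fderiv ℝ (fun y => christoffel G y u w) x v + christoffel G x v (christoffel G x u w)) -
    (fderiv ℝ (fun y => christoffel G y v w) x u + christoffel G x u (christoffel G x v w))

/-! ### Tensor calculus on a manifold -/

section Manifold

variable {n : ℕ} {M : Type*} [TopologicalSpace M] [ChartedSpace (Model n) M]

/-- A covariant `k`-tensor field on `M`: `T p v` is the value at `p` on the tangent vectors
`v 0, …, v (k-1)`. All the fields formed below from smooth data are multilinear in `v`. -/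
abbrev CovTensor (n k : ℕ) (M : Type*) [TopologicalSpace M] [ChartedSpace (Model n) M] : Type _ :=
  ∀ p : M, (Fin k → TangentSpace (𝓡 n) p) → ℝ

/-- A function, as a covariant `0`-tensor field. -/
def ofFun (u : M → ℝ) : CovTensor n 0 M := fun p _ => u p

/-- The expression of a covariant tensor field in the preferred chart at `p`, i.e. its pull-back
under the inverse of that chart. -/
def inChart {k : ℕ} (p : M) (T : CovTensor n k M) : CoordTensor n k := fun x v =>
  T ((extChartAt (𝓡 n) p).symm x)
    fun i => mfderiv 𝓘(ℝ, Model n) (𝓡 n) (extChartAt (𝓡 n) p).symm x (v i)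

variable [IsManifold (𝓡 n) ∞ M]

variable (n M) in
/-- Smooth Riemannian metrics on `M`. -/
abbrev Metric : Type _ :=
  ContMDiffRiemannianMetric (𝓡 n) ∞ (Model n) (fun p : M => TangentSpace (𝓡 n) p)

variable (g : Metric n M)

/-- The metric as a covariant `2`-tensor field. -/
def metricTensor : CovTensor n 2 M := fun p v => g.inner p (v 0) (v 1)

/-- The trace `g^{ij} B(∂ᵢ, ∂ⱼ)` with respect to the metric at `p`; it equals `∑ₖ B(eₖ, eₖ)` in any
orthonormal frame `e` when `B` is bilinear. -/
def traceAt (p : M) (B : TangentSpace (𝓡 n) p → TangentSpace (𝓡 n) p → ℝ) : ℝ :=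
  ∑ i, ∑ j, invGram (fun a b : Model n => g.inner p a b) i j * B (coordVec i) (coordVec j)

/-- The covariant derivative `∇T` of a covariant tensor field for the Levi-Civita connection of
`g`, computed at `p` in the preferred chart at `p` (which is the one by which `TangentSpace (𝓡 n) p`
is identified with `ℝⁿ`). The last slot is the direction of differentiation: in an
orthonormal frame `∇T p ![e i, e j, e k] = T_{ij,k}`. -/
def covDeriv {k : ℕ} (T : CovTensor n k M) : CovTensor n (k + 1) M := fun p v =>
  coordCovDeriv (inChart p (metricTensor g)) (inChart p T) (extChartAt (𝓡 n) p p) v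

/-- The Riemann curvature tensor `R(u, v, w, z) = ⟨R(u, v)w, z⟩` with
`R(u, v)w = ∇_v ∇_u w - ∇_u ∇_v w + ∇_{[u, v]} w`. -/
def riemann : CovTensor n 4 M := fun p v =>
  g.inner p
    (coordCurvOp (inChart p (metricTensor g)) (extChartAt (𝓡 n) p p) (v 0) (v 1) (v 2)) (v 3)

/-- The Ricci tensor `Ric_{ij} = R_{kikj}`. -/
def ricci : CovTensor n 2 M := fun p v =>
  traceAt g p fun a b => riemann g p ![a, v 0, b, v 1]

/-- The trace of a `2`-tensor field. -/
def trace (B : CovTensor n 2 M) : M → ℝ := fun p => traceAt g p fun a b => B p ![a, b]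

/-- The scalar curvature. -/
def scalarCurv : M → ℝ := trace g (ricci g)

/-- The gradient: the vector with components `g^{ij} df(∂ⱼ)`. -/
def grad (f : M → ℝ) (p : M) : TangentSpace (𝓡 n) p :=
  (WithLp.toLp 2 fun i => ∑ j, invGram (fun a b : Model n => g.inner p a b) i j *
    covDeriv g (ofFun f) p ![coordVec j] : Model n)

/-- The Hessian `∇∇f`. -/
def hess (f : M → ℝ) : CovTensor n 2 M := covDeriv g (covDeriv g (ofFun f))

/-- The (rough) Laplacian `ΔT = T_{…,kk}`. -/
def laplacian {k : ℕ} (T : CovTensor n k M) : CovTensor n k M := fun p v =>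
  traceAt g p fun a b => covDeriv g (covDeriv g T) p (Fin.snoc (Fin.snoc v a) b)

/-- The drift Laplacian `𝓛 = Δ - ∇_{∇f}` on covariant tensor fields. -/
def driftLaplacian (f : M → ℝ) {k : ℕ} (T : CovTensor n k M) : CovTensor n k M := fun p v =>
  laplacian g T p v - covDeriv g T p (Fin.snoc v (grad g f p))

/-- The operator `(L B)_{ij} = (𝓛 B)_{ij} + 2 R_{likj} B_{lk}` on `2`-tensor fields. -/
def opL (f : M → ℝ) (B : CovTensor n 2 M) : CovTensor n 2 M := fun p v =>
  driftLaplacian g f B p v +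
    2 * traceAt g p fun a a' => traceAt g p fun b b' =>
      riemann g p ![a, v 0, b, v 1] * B p ![a', b']

/-- The tensor `φ = κ g - Ric - Hess_f`. -/
def solitonDefect (f : M → ℝ) (κ : ℝ) : CovTensor n 2 M := fun p v =>
  κ * metricTensor g p v - ricci g p v - hess g f p v

end Manifold

end

end RicciDrift

open RicciDrift

/-! Since the metric is parallel, `φ = κ g - Ric - Hess_f` gives `Ric_{ij,kk} = -φ_{ij,kk} -
f_{ij,kk}`, so the task is to compute the Laplacian of the Hessian. Commuting derivatives turns
`f_{ij,kk}` into `f_{kk,ij}` plus terms `R * Hess f` and `∇R * ∇f`. The twice contracted Bianchi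
identity `Ric_{kk,ij} = 2 Ric_{ik,kj}` removes the second derivatives of `Ric` from `φ_{kk,ij} - 2
φ_{ik,kj}`, so this combination determines `f_{kk,ij}` up to curvature terms. The once contracted
Bianchi identity collapses the terms `∇R * ∇f` to `-∇_{∇f} Ric`, which cancels the drift. Finally `R
* Hess f` is rewritten by the definition of `φ`, which yields `2κ Ric`, `R * φ` and the zeroth-order
term of `L`. The scalar formula is the trace. This algebra is `SolitonComponents.ricci_evolution`
and `SolitonComponents.scalar_evolution`, with the main commutation in `SolitonComponents.sum_DDH`.

The relations that feed it are proved on open sets of the model space with constant vector fields.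
The Koszul formula `two_mul_christoffel` gives the Levi-Civita properties, and `ricci_identity` is
the source of most of the rest: antisymmetry of the curvature in its last pair, the second Bianchi
identity, the symmetry of Hessians and the naturality of curvature. `coordCovDeriv_contr` lets
traces pass through derivatives, so an orthonormal frame is needed at one point only.

On the manifold every operator is defined at a point through the chart preferred there. Transition
maps are isometries of the chart metrics and all constructions are natural under isometries, so one
chart computes them on its whole domain (`inChart_eq_of_natural`, `inChart_covDeriv`,
`inChart_ricci`). -/

namespace RicciDrift

open Set Function

/-! ### Smooth fields of multilinear maps on open subsets of the model space. -/

variable {n k : ℕ} {F F' : Type*} [NormedAddCommGroup F] [NormedSpace ℝ F]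
  [NormedAddCommGroup F'] [NormedSpace ℝ F'] {U : Set (Model n)}

/-- `T` is a smooth field on `U` of `k`-linear maps with values in `F`. -/
structure IsTensorOn (U : Set (Model n)) (T : Model n → (Fin k → Model n) → F) : Prop where
  multilinear : ∀ x ∈ U, ∃ m : MultilinearMap ℝ (fun _ : Fin k => Model n) F, ⇑m = T x
  smooth : ContDiffOn ℝ ∞ (fun z : Model n × (Fin k → Model n) => T z.1 z.2) (U ×ˢ univ)

namespace IsTensorOn

variable {T T' : Model n → (Fin k → Model n) → F}

/-- Additivity and homogeneity are packed into one identity per slot; the case `c = 1`, `a = b = 0`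
gives vanishing at `0`, which separates the two. -/
theorem of_update (h : ∀ x ∈ U, ∀ (v : Fin k → Model n) i (c : ℝ) a b,
      T x (update v i (c • a + b)) = c • T x (update v i a) + T x (update v i b))
    (hs : ContDiffOn ℝ ∞ (fun z : Model n × (Fin k → Model n) => T z.1 z.2) (U ×ˢ univ)) :
    IsTensorOn U T where
  smooth := hs
  multilinear x hx := by
    have h0 : ∀ v i, T x (update v i 0) = 0 := fun v i => by
      have := h x hx v i 1 0 0
      simpa using this
    refine ⟨⟨T x, ?_, ?_⟩, rfl⟩
    · intro _ v i a b
      have := h x hx v i 1 a b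
      rw [one_smul, one_smul] at this
      -- `MultilinearMap` quantifies over all instances of decidable equality on the index type;
      -- `convert` identifies the given one with the standard one.
      convert this
    · intro _ v i c a
      have := h x hx v i c a 0
      rw [add_zero, h0, add_zero] at this
      convert this

/-- The value of a tensor field at a point, as a multilinear map. -/
noncomputable def toMultilinear (hT : IsTensorOn U T) {x : Model n} (hx : x ∈ U) :
    MultilinearMap ℝ (fun _ : Fin k => Model n) F :=
  (hT.multilinear x hx).choose

@[simp] theorem toMultilinear_apply (hT : IsTensorOn U T) {x : Model n} (hx : x ∈ U) (v) :
    hT.toMultilinear hx v = T x v :=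
  congrFun (hT.multilinear x hx).choose_spec v

theorem update_lin (hT : IsTensorOn U T) {x : Model n} (hx : x ∈ U) (v : Fin k → Model n) (i)
    (c : ℝ) (a b) : T x (update v i (c • a + b)) =
      c • T x (update v i a) + T x (update v i b) := by
  simp only [← hT.toMultilinear_apply hx, MultilinearMap.map_update_add,
    MultilinearMap.map_update_smul]

/-- This is the use of joint smoothness in point and vectors: both may depend on a parameter. -/
theorem contDiffOn (hT : IsTensorOn U T) {X : Type*} [NormedAddCommGroup X] [NormedSpace ℝ X]
    {s : Set X} {φ : X → Model n} {w : X → Fin k → Model n} (hφ : ContDiffOn ℝ ∞ φ s)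
    (hw : ContDiffOn ℝ ∞ w s) (hs : MapsTo φ s U) : ContDiffOn ℝ ∞ (fun y => T (φ y) (w y)) s :=
  hT.smooth.comp (hφ.prodMk hw) fun _ hy => ⟨hs hy, mem_univ _⟩

theorem contDiffOn_apply (hT : IsTensorOn U T) (v : Fin k → Model n) :
    ContDiffOn ℝ ∞ (fun y => T y v) U :=
  hT.contDiffOn contDiffOn_id contDiffOn_const fun _ h => h

theorem continuous (hT : IsTensorOn U T) {x : Model n} (hx : x ∈ U) : Continuous (T x) := by
  have : ContDiffOn ℝ ∞ (fun v : Fin k → Model n => T x v) univ :=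
    hT.contDiffOn contDiffOn_const contDiffOn_id fun _ _ => hx
  exact (contDiffOn_univ.1 this).continuous

theorem differentiableAt (hT : IsTensorOn U T) (hU : IsOpen U) {x : Model n} (hx : x ∈ U)
    (v : Fin k → Model n) : DifferentiableAt ℝ (fun y => T y v) x :=
  ((hT.contDiffOn_apply v).contDiffAt (hU.mem_nhds hx)).differentiableAt (by simp)

/-- The value of a tensor field at a point, as a continuous multilinear map. -/
noncomputable def toCMM (hT : IsTensorOn U T) {x : Model n} (hx : x ∈ U) :
    ContinuousMultilinearMap ℝ (fun _ : Fin k => Model n) F :=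
  { hT.toMultilinear hx with
    cont := by
      have := hT.continuous hx
      convert this using 1
      ext v
      exact hT.toMultilinear_apply hx v }

@[simp] theorem toCMM_apply (hT : IsTensorOn U T) {x : Model n} (hx : x ∈ U) (v) :
    hT.toCMM hx v = T x v :=
  hT.toMultilinear_apply hx v

/-- The chain rule for a tensor field along a map, evaluated on variable vectors. -/
theorem fderiv_comp (hT : IsTensorOn U T) (hU : IsOpen U) {X : Type*} [NormedAddCommGroup X]
    [NormedSpace ℝ X] {φ : X → Model n} {w : X → Fin k → Model n} {x : X}
    (hφ : DifferentiableAt ℝ φ x) (hw : DifferentiableAt ℝ w x) (hx : φ x ∈ U) (u : X) :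
    fderiv ℝ (fun y => T (φ y) (w y)) x u =
      fderiv ℝ (fun y => T y (w x)) (φ x) (fderiv ℝ φ x u) +
        ∑ s, T (φ x) (update (w x) s (fderiv ℝ w x u s)) := by
  set S : Model n × (Fin k → Model n) → F := fun z => T z.1 z.2 with hS
  have hd : DifferentiableAt ℝ S (φ x, w x) :=
    (hT.smooth.contDiffAt ((hU.prod isOpen_univ).mem_nhds ⟨hx, mem_univ _⟩)).differentiableAt
      (by simp)
  have h1 : HasFDerivAt (fun y => S (φ y, w y))
      ((fderiv ℝ S (φ x, w x)).comp ((fderiv ℝ φ x).prod (fderiv ℝ w x))) x :=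
    HasFDerivAt.comp (f := fun y => (φ y, w y)) x hd.hasFDerivAt
      (hφ.hasFDerivAt.prodMk hw.hasFDerivAt)
  have h2 : HasFDerivAt (fun y => S (y, w x))
      ((fderiv ℝ S (φ x, w x)).comp ((ContinuousLinearMap.id ℝ _).prod 0)) (φ x) :=
    HasFDerivAt.comp (f := fun y => (y, w x)) (φ x) hd.hasFDerivAt
      ((hasFDerivAt_id _).prodMk (hasFDerivAt_const _ _))
  have h3 : HasFDerivAt (fun v => S (φ x, v))
      ((fderiv ℝ S (φ x, w x)).comp (ContinuousLinearMap.prod 0 (ContinuousLinearMap.id ℝ _)))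
      (w x) :=
    HasFDerivAt.comp (f := fun v => (φ x, v)) (w x) hd.hasFDerivAt
      ((hasFDerivAt_const _ _).prodMk (hasFDerivAt_id _))
  -- The partial derivative in the vectors is that of a multilinear map, which replaces one slot at
  -- a time; uniqueness of derivatives compares it with `h3`.
  have h4 : HasFDerivAt (fun v => S (φ x, v)) ((hT.toCMM hx).linearDeriv (w x)) (w x) := by
    have := (hT.toCMM hx).hasFDerivAt (w x)
    convert this using 1
    ext v
    simp [hS]
  have h5 := congrArg (fun L => L (fderiv ℝ w x u)) (h3.unique h4)
  rw [ContinuousMultilinearMap.linearDeriv_apply] at h5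
  simp only [toCMM_apply] at h5
  rw [show (fun y => T (φ y) (w y)) = fun y => S (φ y, w y) from rfl, h1.fderiv,
    show (fun y => T y (w x)) = fun y => S (y, w x) from rfl, h2.fderiv, ← h5]
  simp only [ContinuousLinearMap.comp_apply, ContinuousLinearMap.prod_apply,
    ContinuousLinearMap.id_apply, _root_.zero_apply, ← map_add, Prod.mk_add_mk,
    add_zero, zero_add]

theorem congr (hT : IsTensorOn U T) (h : ∀ x ∈ U, T' x = T x) : IsTensorOn U T' where
  multilinear x hx := by rw [h x hx]; exact hT.multilinear x hx
  smooth := hT.smooth.congr fun z hz => by rw [h z.1 hz.1]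

theorem mono (hT : IsTensorOn U T) {V : Set (Model n)} (h : V ⊆ U) : IsTensorOn V T where
  multilinear x hx := hT.multilinear x (h hx)
  smooth := hT.smooth.mono (prod_mono_left h)

theorem add (hT : IsTensorOn U T) (hT' : IsTensorOn U T') :
    IsTensorOn U fun x v => T x v + T' x v :=
  of_update (fun x hx v i c a b => by
    rw [hT.update_lin hx, hT'.update_lin hx, smul_add]; abel) (hT.smooth.add hT'.smooth)

theorem const_smul (hT : IsTensorOn U T) (c : ℝ) : IsTensorOn U fun x v => c • T x v :=
  of_update (fun x hx v i d a b => by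
    rw [hT.update_lin hx, smul_add, smul_comm]) (contDiffOn_const.smul hT.smooth)

theorem sub (hT : IsTensorOn U T) (hT' : IsTensorOn U T') :
    IsTensorOn U fun x v => T x v - T' x v :=
  of_update (fun x hx v i c a b => by
    rw [hT.update_lin hx, hT'.update_lin hx, smul_sub]; abel) (hT.smooth.sub hT'.smooth)

theorem perm (hT : IsTensorOn U T) (σ : Equiv.Perm (Fin k)) :
    IsTensorOn U fun x v => T x fun i => v (σ i) :=
  of_update (fun x hx v i c a b => by
    have : ∀ a, (fun j => update v i a (σ j)) = update (fun j => v (σ j)) (σ.symm i) a := by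
      intro a
      ext j : 1
      by_cases hj : σ j = i
      · subst hj; simp
      · rw [update_of_ne hj, update_of_ne]
        rintro rfl; simp at hj
    simp only [this, hT.update_lin hx])
    (hT.contDiffOn contDiffOn_fst (by fun_prop) fun z hz => hz.1)

end IsTensorOn

/-- The derivative of a smooth map on an open set, as a map of the point and of the direction,
along further smooth data. -/
theorem contDiffOn_fderiv_apply {X Y : Type*} [NormedAddCommGroup X] [NormedSpace ℝ X]
    [NormedAddCommGroup Y] [NormedSpace ℝ Y] {s : Set X} {S : X → F} (hs : IsOpen s)
    (hS : ContDiffOn ℝ ∞ S s) {t : Set Y} {φ u : Y → X} (hφ : ContDiffOn ℝ ∞ φ t)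
    (hu : ContDiffOn ℝ ∞ u t) (h : MapsTo φ t s) :
    ContDiffOn ℝ ∞ (fun y => fderiv ℝ S (φ y) (u y)) t :=
  ((hS.fderiv_of_isOpen hs (m := ∞) (by simp)).comp hφ h).clm_apply hu

theorem fderiv_fderiv_comm {X : Type*} [NormedAddCommGroup X] [NormedSpace ℝ X] {s : Set X}
    {S : X → F} (hs : IsOpen s) (hS : ContDiffOn ℝ ∞ S s) {x : X} (hx : x ∈ s) (u v : X) :
    fderiv ℝ (fun y => fderiv ℝ S y u) x v = fderiv ℝ (fun y => fderiv ℝ S y v) x u := by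
  have h := hS.contDiffAt (hs.mem_nhds hx)
  have hd : DifferentiableAt ℝ (fderiv ℝ S) x :=
    (h.fderiv_right (m := 1) (by norm_cast)).differentiableAt (by simp)
  have := h.isSymmSndFDerivAt (by simpa using ENat.LEInfty.out) v u
  rw [fderiv_clm_apply hd (differentiableAt_const u),
    fderiv_clm_apply hd (differentiableAt_const v)]
  simpa using this

/-- The derivative of a tensor field in its point, as a tensor field with one more slot. -/
theorem IsTensorOn.fderiv_snoc {T : Model n → (Fin k → Model n) → F} (hT : IsTensorOn U T)
    (hU : IsOpen U) : IsTensorOn U fun x (v : Fin (k + 1) → Model n) =>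
      fderiv ℝ (fun y => T y (Fin.init v)) x (v (Fin.last k)) := by
  refine IsTensorOn.of_update ?_ ?_
  · intro x hx v i c a b
    refine Fin.lastCases ?_ (fun j => ?_) i
    · simp
    · simp only [Fin.init_update_castSucc, ne_eq, (Fin.castSucc_lt_last j).ne', not_false_eq_true,
        update_of_ne]
      have h1 := hT.differentiableAt hU hx (update (Fin.init v) j a)
      have h2 := hT.differentiableAt hU hx (update (Fin.init v) j b)
      rw [(Filter.eventuallyEq_of_mem (hU.mem_nhds hx) fun y hy =>
        hT.update_lin hy _ j c a b).fderiv_eq, fderiv_fun_add (h1.fun_const_smul c) h2,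
        fderiv_fun_const_smul h1]
      simp
  -- The partial derivative in the point is the total derivative in a direction with zero vector
  -- part, so it inherits joint smoothness.
  · have h1 : ∀ z : Model n × (Fin (k + 1) → Model n), z ∈ U ×ˢ univ →
        fderiv ℝ (fun y => T y (Fin.init z.2)) z.1 (z.2 (Fin.last k)) =
          fderiv ℝ (fun z : Model n × (Fin k → Model n) => T z.1 z.2) (z.1, Fin.init z.2)
            (z.2 (Fin.last k), 0) := by
      intro z hz
      have hd : DifferentiableAt ℝ (fun z : Model n × (Fin k → Model n) => T z.1 z.2)
          (z.1, Fin.init z.2) :=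
        (hT.smooth.contDiffAt ((hU.prod isOpen_univ).mem_nhds ⟨hz.1, mem_univ _⟩)).differentiableAt
          (by simp)
      have := HasFDerivAt.comp (f := fun y => (y, Fin.init z.2)) z.1 hd.hasFDerivAt
        ((hasFDerivAt_id z.1).prodMk (hasFDerivAt_const (Fin.init z.2) z.1))
      have h := this.fderiv
      simp only [comp_def] at h
      rw [h]
      simp
    refine ContDiffOn.congr ?_ h1
    refine contDiffOn_fderiv_apply (hU.prod isOpen_univ) hT.smooth ?_ ?_ fun z hz =>
      ⟨hz.1, mem_univ _⟩
    · refine ContDiff.contDiffOn (ContDiff.prodMk contDiff_fst ?_)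
      unfold Fin.init
      fun_prop
    · refine ContDiff.contDiffOn (ContDiff.prodMk ?_ contDiff_const)
      fun_prop

/-- Substituting the values of a bilinear field in a slot of a tensor field. -/
theorem IsTensorOn.update_snoc {T : Model n → (Fin k → Model n) → F} (hT : IsTensorOn U T)
    {B : Model n → (Fin 2 → Model n) → Model n} (hB : IsTensorOn U B) (s : Fin k) :
    IsTensorOn U fun x (v : Fin (k + 1) → Model n) =>
      T x (update (Fin.init v) s (B x ![v (Fin.last k), v s.castSucc])) := by
  refine IsTensorOn.of_update ?_ ?_
  · intro x hx v i c a b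
    have e0 : ∀ a b c : Model n, update ![a, b] 0 c = ![c, b] := fun a b c => by
      ext i : 1; fin_cases i <;> rfl
    have e1 : ∀ a b c : Model n, update ![a, b] 1 c = ![a, c] := fun a b c => by
      ext i : 1; fin_cases i <;> rfl
    refine Fin.lastCases ?_ (fun j => ?_) i
    · have := hB.update_lin hx ![0, v s.castSucc] 0 c a b
      simp only [e0] at this
      simp [this, (Fin.castSucc_lt_last s).ne, hT.update_lin hx]
    · simp only [Fin.init_update_castSucc, ne_eq, (Fin.castSucc_lt_last j).ne', not_false_eq_true,
        update_of_ne]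
      by_cases hj : j = s
      · subst hj
        have := hB.update_lin hx ![v (Fin.last k), 0] 1 c a b
        simp only [e1] at this
        simp [this, hT.update_lin hx]
      · simp only [ne_eq, Fin.castSucc_inj, Ne.symm hj, not_false_eq_true, update_of_ne,
          update_comm hj]
        exact hT.update_lin hx _ _ _ _ _
  · have hB' : ContDiffOn ℝ ∞ (fun z : Model n × (Fin (k + 1) → Model n) =>
        B z.1 ![z.2 (Fin.last k), z.2 s.castSucc]) (U ×ˢ univ) :=
      hB.contDiffOn contDiffOn_fst (contDiffOn_pi.2 fun i => by fin_cases i <;> simp <;> fun_prop)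
        fun z hz => hz.1
    refine hT.contDiffOn contDiffOn_fst (contDiffOn_pi.2 fun i => ?_) fun z hz => hz.1
    by_cases hi : i = s
    · subst hi; simpa using hB'
    · simp only [ne_eq, hi, not_false_eq_true, update_of_ne]
      unfold Fin.init
      fun_prop

/-! ### Linear algebra of a scalar product on the model space -/

theorem sum_coordVec {n : ℕ} (w : Model n) : ∑ i, w i • coordVec i = w := by
  ext j
  simp [coordVec, Pi.single_apply]

/-- The vectors `∑ᵢ b^{ij} ∂ᵢ`, dual to the coordinate vectors for the scalar product `b`. -/
noncomputable def dualVec {n : ℕ} (b : Model n → Model n → ℝ) (j : Fin n) : Model n :=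
  WithLp.toLp 2 fun i => invGram b i j

section ScalarProduct

variable {n : ℕ} {B : Model n →ₗ[ℝ] Model n →ₗ[ℝ] ℝ}

/-- A kernel vector of the Gram matrix would be null for `B`, against positivity. -/
theorem isUnit_det_gram (hpos : ∀ a, a ≠ 0 → 0 < B a a) :
    IsUnit (Matrix.of fun i j => B (coordVec i) (coordVec j)).det := by
  rw [isUnit_iff_ne_zero]
  intro h
  obtain ⟨c, hc, h0⟩ := Matrix.exists_mulVec_eq_zero_iff.2 h
  have hne : (WithLp.toLp 2 c : Model n) ≠ 0 := by
    intro h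
    apply hc
    ext i
    simpa using congrArg (fun z : Model n => z i) h
  refine (hpos _ hne).ne' ?_
  rw [← sum_coordVec (WithLp.toLp 2 c : Model n)]
  simp only [map_sum, map_smul, LinearMap.sum_apply, LinearMap.smul_apply, smul_eq_mul]
  simp_rw [Finset.mul_sum]
  rw [Finset.sum_comm]
  refine Finset.sum_eq_zero fun i _ => ?_
  have := congrFun h0 i
  simp only [Matrix.mulVec, dotProduct, Matrix.of_apply, Pi.zero_apply] at this
  calc _ = c i * ∑ j, B (coordVec i) (coordVec j) * c j := by
        rw [Finset.mul_sum]; refine Finset.sum_congr rfl fun j _ => ?_; ring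
    _ = 0 := by rw [this, mul_zero]

/-- Entrywise, this is the Gram matrix times its inverse. Most later arguments use this duality
instead of the inverse matrix. -/
theorem dualVec_left (hsymm : ∀ a b, B a b = B b a) (hpos : ∀ a, a ≠ 0 → 0 < B a a) (j : Fin n)
    (w : Model n) : B (dualVec (fun a b => B a b) j) w = w j := by
  have hA := Matrix.mul_nonsing_inv _ (isUnit_det_gram hpos)
  have key : ∀ i, B (dualVec (fun a b => B a b) j) (coordVec i) = if i = j then 1 else 0 := by
    intro i
    rw [← sum_coordVec (dualVec (fun a b => B a b) j)]
    have := congrFun (congrFun hA i) j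
    rw [Matrix.mul_apply, Matrix.one_apply] at this
    rw [← this]
    simp only [map_sum, map_smul, LinearMap.sum_apply, LinearMap.smul_apply, smul_eq_mul]
    refine Finset.sum_congr rfl fun l _ => ?_
    rw [hsymm, mul_comm]
    rfl
  conv_lhs => rw [← sum_coordVec w]
  simp [key]

theorem eq_of_forall_pairing (hpos : ∀ a, a ≠ 0 → 0 < B a a) {a b : Model n}
    (h : ∀ w, B a w = B b w) : a = b := by
  by_contra hne
  have := hpos (a - b) (sub_ne_zero.2 hne)
  rw [LinearMap.map_sub₂, h, sub_self] at this
  exact this.false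

/-- Puts a trace in the form of a sum over two dual families, which can be changed by
`sum_dualVec_eq`. -/
theorem sum_invGram_mul (C : Model n →ₗ[ℝ] Model n →ₗ[ℝ] ℝ) (b : Model n → Model n → ℝ) :
    ∑ i, ∑ j, invGram b i j * C (coordVec i) (coordVec j) = ∑ j, C (dualVec b j) (coordVec j) := by
  rw [Finset.sum_comm]
  refine Finset.sum_congr rfl fun j _ => ?_
  conv_rhs => rw [← sum_coordVec (dualVec b j)]
  simp [dualVec]

theorem sum_pairing_smul_dualVec (hsymm : ∀ a b, B a b = B b a) (hpos : ∀ a, a ≠ 0 → 0 < B a a)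
    (a : Model n) : ∑ j, B a (coordVec j) • dualVec (fun a b => B a b) j = a := by
  refine eq_of_forall_pairing hpos fun w => ?_
  conv_rhs => rw [← sum_coordVec w]
  simp [dualVec_left hsymm hpos, mul_comm]

/-- The trace with respect to a scalar product, from any pair of dual families. -/
theorem sum_dualVec_eq (hsymm : ∀ a b, B a b = B b a) (hpos : ∀ a, a ≠ 0 → 0 < B a a)
    {ι : Type*} [Fintype ι] {a b : ι → Model n} (hab : ∀ w, ∑ i, B (a i) w • b i = w)
    (C : Model n →ₗ[ℝ] Model n →ₗ[ℝ] ℝ) :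
    ∑ j, C (dualVec (fun a b => B a b) j) (coordVec j) = ∑ i, C (a i) (b i) := by
  have h1 : ∀ j, C (dualVec (fun a b => B a b) j) (coordVec j) =
      ∑ i, B (a i) (coordVec j) * C (dualVec (fun a b => B a b) j) (b i) := fun j => by
    conv_lhs => rw [← hab (coordVec j)]
    simp
  simp_rw [h1]
  rw [Finset.sum_comm]
  refine Finset.sum_congr rfl fun i _ => ?_
  conv_rhs => rw [← sum_pairing_smul_dualVec hsymm hpos (a i)]
  simp

/-- Orthonormal vectors are independent, so `n` of them span; the pairing then reads off the
coefficients. -/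
theorem sum_orthonormal {e : Fin n → Model n}
    (he : ∀ i j, B (e i) (e j) = if i = j then 1 else 0) (w : Model n) :
    ∑ i, B (e i) w • e i = w := by
  have hli : LinearIndependent ℝ e := by
    rw [Fintype.linearIndependent_iff]
    intro c hc i
    have := congrArg (B (e i)) hc
    simpa [he] using this
  have hspan : ⊤ ≤ Submodule.span ℝ (range e) :=
    (hli.span_eq_top_of_card_eq_finrank' (by simp)).ge
  obtain ⟨c, rfl⟩ := (Submodule.mem_span_range_iff_exists_fun ℝ).1
    (hspan (Submodule.mem_top (x := w)))
  simp [he]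

end ScalarProduct

theorem ContDiffOn.matrix_det {X ι : Type*} [NormedAddCommGroup X] [NormedSpace ℝ X] [Fintype ι]
    [DecidableEq ι] {s : Set X} {A : X → Matrix ι ι ℝ}
    (hA : ∀ i j, ContDiffOn ℝ ∞ (fun x => A x i j) s) : ContDiffOn ℝ ∞ (fun x => (A x).det) s := by
  simp only [Matrix.det_apply]
  simp only [Units.smul_def, zsmul_eq_mul]
  exact ContDiffOn.sum fun σ _ => contDiffOn_const.mul (contDiffOn_prod fun i _ => hA _ _)

/-- Cramer's rule: the entries of the adjugate are determinants, divided by a determinant without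
zeros. -/
theorem ContDiffOn.matrix_inv {X ι : Type*} [NormedAddCommGroup X] [NormedSpace ℝ X] [Fintype ι]
    [DecidableEq ι] {s : Set X} {A : X → Matrix ι ι ℝ}
    (hA : ∀ i j, ContDiffOn ℝ ∞ (fun x => A x i j) s) (h : ∀ x ∈ s, IsUnit (A x).det) (i j : ι) :
    ContDiffOn ℝ ∞ (fun x => (A x)⁻¹ i j) s := by
  simp only [Matrix.inv_def, Matrix.smul_apply, Ring.inverse_eq_inv', smul_eq_mul,
    Matrix.adjugate_apply]
  refine ((ContDiffOn.matrix_det hA).inv fun x hx => (h x hx).ne_zero).mul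
    (ContDiffOn.matrix_det fun a b => ?_)
  by_cases ha : a = j
  · subst ha; simp [contDiffOn_const]
  · simpa [Matrix.updateRow_apply, ha] using hA a b

/-! ### Tensor fields in low rank -/

section LowRank

variable {E : Type*} {n : ℕ}

theorem update_vec1 (a c : E) : update ![a] 0 c = ![c] := by ext i : 1; fin_cases i; rfl
theorem update_vec2_zero (a b c : E) : update ![a, b] 0 c = ![c, b] := by
  ext i : 1; fin_cases i <;> rfl
theorem update_vec2_one (a b c : E) : update ![a, b] 1 c = ![a, c] := by
  ext i : 1; fin_cases i <;> rfl
theorem update_vec3_zero (a b c d : E) : update ![a, b, c] 0 d = ![d, b, c] := by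
  ext i : 1; fin_cases i <;> rfl
theorem update_vec3_one (a b c d : E) : update ![a, b, c] 1 d = ![a, d, c] := by
  ext i : 1; fin_cases i <;> rfl
theorem update_vec3_two (a b c d : E) : update ![a, b, c] 2 d = ![a, b, d] := by
  ext i : 1; fin_cases i <;> rfl
theorem update_vec4_zero (a b c d z : E) : update ![a, b, c, d] 0 z = ![z, b, c, d] := by
  ext i : 1; fin_cases i <;> rfl
theorem update_vec4_one (a b c d z : E) : update ![a, b, c, d] 1 z = ![a, z, c, d] := by
  ext i : 1; fin_cases i <;> rfl
theorem update_vec4_two (a b c d z : E) : update ![a, b, c, d] 2 z = ![a, b, z, d] := by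
  ext i : 1; fin_cases i <;> rfl
theorem update_vec4_three (a b c d z : E) : update ![a, b, c, d] 3 z = ![a, b, c, z] := by
  ext i : 1; fin_cases i <;> rfl

end LowRank

namespace IsTensorOn

variable {n k : ℕ} {F : Type*} [NormedAddCommGroup F] [NormedSpace ℝ F] {U : Set (Model n)}
  {x : Model n}

/-- A tensor field at a point as a linear map of one slot. -/
noncomputable def slot {T : Model n → (Fin k → Model n) → F} (hT : IsTensorOn U T) (hx : x ∈ U)
    (v : Fin k → Model n) (i : Fin k) : Model n →ₗ[ℝ] F :=
  (hT.toMultilinear hx).toLinearMap v i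

theorem slot_apply {T : Model n → (Fin k → Model n) → F} (hT : IsTensorOn U T) (hx : x ∈ U)
    (v : Fin k → Model n) (i : Fin k) (a : Model n) : hT.slot hx v i a = T x (update v i a) := by
  simp [slot]

theorem update_zero {T : Model n → (Fin k → Model n) → F} (hT : IsTensorOn U T) (hx : x ∈ U)
    (v : Fin k → Model n) (i : Fin k) : T x (update v i 0) = 0 := by
  rw [← hT.slot_apply hx, map_zero]

/-- A `2`-tensor field at a point as a bilinear map. -/
noncomputable def bilin {T : Model n → (Fin 2 → Model n) → F} (hT : IsTensorOn U T) (hx : x ∈ U) :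
    Model n →ₗ[ℝ] Model n →ₗ[ℝ] F :=
  LinearMap.mk₂ ℝ (fun a b => T x ![a, b])
    (fun a b c => by
      have := (hT.slot hx ![0, c] 0).map_add a b
      simpa only [slot_apply, update_vec2_zero] using this)
    (fun r a c => by
      have := (hT.slot hx ![0, c] 0).map_smul r a
      simpa only [slot_apply, update_vec2_zero] using this)
    (fun a b c => by
      have := (hT.slot hx ![a, 0] 1).map_add b c
      simpa only [slot_apply, update_vec2_one] using this)
    (fun r a c => by
      have := (hT.slot hx ![a, 0] 1).map_smul r c
      simpa only [slot_apply, update_vec2_one] using this)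

@[simp] theorem bilin_apply {T : Model n → (Fin 2 → Model n) → F} (hT : IsTensorOn U T)
    (hx : x ∈ U) (a b : Model n) : hT.bilin hx a b = T x ![a, b] := rfl

/-- A `1`-tensor field at a point as a linear map. -/
noncomputable def lin {T : Model n → (Fin 1 → Model n) → F} (hT : IsTensorOn U T) (hx : x ∈ U) :
    Model n →ₗ[ℝ] F where
  toFun a := T x ![a]
  map_add' a b := by
    have := (hT.slot hx ![0] 0).map_add a b
    simpa only [slot_apply, update_vec1] using this
  map_smul' r a := by
    have := (hT.slot hx ![0] 0).map_smul r a
    simpa only [slot_apply, update_vec1, RingHom.id_apply] using this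

@[simp] theorem lin_apply {T : Model n → (Fin 1 → Model n) → F} (hT : IsTensorOn U T)
    (hx : x ∈ U) (a : Model n) : hT.lin hx a = T x ![a] := rfl

end IsTensorOn

/-! ### Metrics on open sets and their Christoffel symbols -/

/-- `G` is a smooth Riemannian metric on the open set `U`. -/
structure IsMetricOn {n : ℕ} (U : Set (Model n)) (G : CoordTensor n 2) : Prop where
  isOpen : IsOpen U
  tensor : IsTensorOn U G
  symm : ∀ x ∈ U, ∀ a b, G x ![a, b] = G x ![b, a]
  pos : ∀ x ∈ U, ∀ a, a ≠ 0 → 0 < G x ![a, a]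

namespace IsMetricOn

variable {n : ℕ} {U : Set (Model n)} {G : CoordTensor n 2} {x : Model n}

theorem dualVec_left (hG : IsMetricOn U G) (hx : x ∈ U) (j : Fin n) (w : Model n) :
    G x ![dualVec (fun a b => G x ![a, b]) j, w] = w j :=
  RicciDrift.dualVec_left (B := hG.tensor.bilin hx) (hG.symm x hx) (hG.pos x hx) j w

theorem ext (hG : IsMetricOn U G) (hx : x ∈ U) {a b : Model n}
    (h : ∀ w, G x ![a, w] = G x ![b, w]) : a = b :=
  eq_of_forall_pairing (B := hG.tensor.bilin hx) (hG.pos x hx) h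

theorem contDiffOn_invGram (hG : IsMetricOn U G) (i j : Fin n) :
    ContDiffOn ℝ ∞ (fun y => invGram (fun a b => G y ![a, b]) i j) U :=
  ContDiffOn.matrix_inv (fun _ _ => hG.tensor.contDiffOn_apply _)
    (fun _ hx => isUnit_det_gram (B := hG.tensor.bilin hx) (hG.pos _ hx)) i j

theorem contDiffOn_dualVec (hG : IsMetricOn U G) (j : Fin n) :
    ContDiffOn ℝ ∞ (fun y => dualVec (fun a b => G y ![a, b]) j) U :=
  contDiffOn_euclidean.2 fun i => hG.contDiffOn_invGram i j

theorem dirDeriv_tensor (hG : IsMetricOn U G) :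
    IsTensorOn U fun y (v : Fin 3 → Model n) => dirDeriv G y (v 2) (v 0) (v 1) := by
  refine (hG.tensor.fderiv_snoc hG.isOpen).congr fun x _ => funext fun v => ?_
  have : (Fin.init v : Fin 2 → Model n) = ![v 0, v 1] := by ext i : 1; fin_cases i <;> rfl
  rw [this]; rfl

/-- The Koszul formula for commuting fields. It determines the Christoffel symbols without reference
to the inverse matrix. -/
theorem two_mul_christoffel (hG : IsMetricOn U G) (hx : x ∈ U) (u v w : Model n) :
    2 * G x ![christoffel G x v w, u] =
      dirDeriv G x v w u + dirDeriv G x w v u - dirDeriv G x u v w := by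
  have hD := hG.dirDeriv_tensor
  -- The right-hand side is linear in `u`, hence determined by its values on the coordinate vectors,
  -- which are what `christoffel` contains.
  set K : Model n →ₗ[ℝ] ℝ :=
    hD.slot hx ![w, 0, v] 1 + hD.slot hx ![v, 0, w] 1 - hD.slot hx ![v, w, 0] 2 with hK
  have hKa : ∀ u, K u = dirDeriv G x v w u + dirDeriv G x w v u - dirDeriv G x u v w := fun u => by
    simp [hK, IsTensorOn.slot_apply]
  have hc : christoffel G x v w =
      (1 / 2 : ℝ) • ∑ l, K (coordVec l) • dualVec (fun a b => G x ![a, b]) l := by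
    ext k
    simp only [christoffel, hKa, dualVec, PiLp.smul_apply, smul_eq_mul, WithLp.ofLp_sum,
      Finset.sum_apply, WithLp.ofLp_smul, Pi.smul_apply]
    congr 1
    exact Finset.sum_congr rfl fun l _ => mul_comm _ _
  rw [← hKa, hc, ← hG.tensor.bilin_apply hx, map_smul, map_sum, LinearMap.smul_apply,
    LinearMap.sum_apply]
  simp only [map_smul, LinearMap.smul_apply, IsTensorOn.bilin_apply, hG.dualVec_left hx]
  conv_rhs => rw [← sum_coordVec u]
  simp [mul_comm]

theorem dirDeriv_symm (hG : IsMetricOn U G) (hx : x ∈ U) (u v w : Model n) :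
    dirDeriv G x u v w = dirDeriv G x u w v := by
  unfold dirDeriv
  rw [(Filter.eventuallyEq_of_mem (hG.isOpen.mem_nhds hx) fun y hy => hG.symm y hy v w).fderiv_eq]

theorem christoffel_comm (hG : IsMetricOn U G) (hx : x ∈ U) (v w : Model n) :
    christoffel G x v w = christoffel G x w v := by
  unfold christoffel
  simp only [hG.dirDeriv_symm hx _ v w]
  congr! 6
  ring

/-- The Levi-Civita connection is metric. -/
theorem dirDeriv_eq (hG : IsMetricOn U G) (hx : x ∈ U) (u v w : Model n) :
    dirDeriv G x u v w = G x ![christoffel G x u v, w] + G x ![v, christoffel G x u w] := by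
  have h1 := hG.two_mul_christoffel hx w u v
  have h2 := hG.two_mul_christoffel hx v u w
  rw [hG.symm x hx] at h2
  have h3 := hG.dirDeriv_symm hx u v w
  have h4 := hG.dirDeriv_symm hx v u w
  have h5 := hG.dirDeriv_symm hx w u v
  linarith

/-- In a fixed chart the Christoffel symbols form a smooth bilinear field, although they do not
transform as a tensor. Bilinearity is tested against the metric with the Koszul formula; smoothness
is read from the definition. -/
theorem christoffel_tensor (hG : IsMetricOn U G) :
    IsTensorOn U fun y (v : Fin 2 → Model n) => christoffel G y (v 0) (v 1) := by
  have hD := hG.dirDeriv_tensor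
  refine IsTensorOn.of_update ?_ ?_
  · intro x hx v i c a b
    have hl := fun a b c => hG.two_mul_christoffel hx a b c
    refine hG.ext hx fun u => ?_
    rw [← hG.tensor.bilin_apply hx (c • _ + _)]
    simp only [map_add, map_smul, LinearMap.add_apply, LinearMap.smul_apply,
      IsTensorOn.bilin_apply, smul_eq_mul]
    apply mul_left_cancel₀ (two_ne_zero (α := ℝ))
    rw [mul_add, mul_left_comm]
    fin_cases i
    · have e1 := hD.update_lin hx ![v 1, u, 0] 2 c a b
      have e2 := hD.update_lin hx ![0, u, v 1] 0 c a b
      have e3 := hD.update_lin hx ![0, v 1, u] 0 c a b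
      simp only [update_vec3_zero, update_vec3_two] at e1 e2 e3
      simp at e1 e2 e3
      simp [hl, e1, e2, e3]
      ring
    · have e1 := hD.update_lin hx ![v 0, u, 0] 2 c a b
      have e2 := hD.update_lin hx ![0, u, v 0] 0 c a b
      have e3 := hD.update_lin hx ![v 0, 0, u] 1 c a b
      simp only [update_vec3_zero, update_vec3_two, update_vec3_one] at e1 e2 e3
      simp at e1 e2 e3
      simp [hl, e1, e2, e3]
      ring
  · refine contDiffOn_euclidean.2 fun i => ?_
    simp only [christoffel]
    refine contDiffOn_const.mul (ContDiffOn.sum fun l _ => ?_)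
    have h0 : ContDiffOn ℝ ∞ (fun z : Model n × (Fin 2 → Model n) =>
        invGram (fun a b => G z.1 ![a, b]) i l) (U ×ˢ univ) :=
      (hG.contDiffOn_invGram i l).comp contDiffOn_fst fun z hz => hz.1
    refine h0.mul ?_
    have hv : ∀ a b c : (Fin 2 → Model n) → Model n, ContDiff ℝ ∞ a → ContDiff ℝ ∞ b →
        ContDiff ℝ ∞ c → ContDiffOn ℝ ∞ (fun z : Model n × (Fin 2 → Model n) =>
          dirDeriv G z.1 (a z.2) (b z.2) (c z.2)) (U ×ˢ univ) := fun a b c ha hb hc => by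
      refine hD.contDiffOn (s := U ×ˢ univ) (w := fun z => ![b z.2, c z.2, a z.2]) contDiffOn_fst
        (ContDiff.contDiffOn (contDiff_pi.2 fun i => ?_)) fun z hz => hz.1
      fin_cases i
      exacts [hb.comp contDiff_snd, hc.comp contDiff_snd, ha.comp contDiff_snd]
    exact ((hv (fun v => v 0) (fun v => v 1) (fun _ => coordVec l) (by fun_prop) (by fun_prop)
      contDiff_const).add (hv (fun v => v 1) (fun v => v 0) (fun _ => coordVec l) (by fun_prop)
      (by fun_prop) contDiff_const)).sub (hv (fun _ => coordVec l) (fun v => v 0) (fun v => v 1)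
      contDiff_const (by fun_prop) (by fun_prop))

end IsMetricOn

/-- Makes it possible to iterate covariant differentiation. -/
theorem IsTensorOn.coordCovDeriv {n k : ℕ} {U : Set (Model n)} {G : CoordTensor n 2}
    {T : CoordTensor n k} (hT : IsTensorOn U T) (hG : IsMetricOn U G) :
    IsTensorOn U (coordCovDeriv G T) := by
  have hsum : IsTensorOn U fun x (v : Fin (k + 1) → Model n) => ∑ s, T x (update (Fin.init v) s
      (christoffel G x (v (Fin.last k)) (v s.castSucc))) := by
    have h := fun s => hT.update_snoc hG.christoffel_tensor s
    refine IsTensorOn.of_update (fun x hx v i c a b => ?_) (ContDiffOn.sum fun s _ => (h s).smooth)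
    rw [Finset.smul_sum, ← Finset.sum_add_distrib]
    exact Finset.sum_congr rfl fun s _ => (h s).update_lin hx v i c a b
  exact (hT.fderiv_snoc hG.isOpen).sub hsum

/-! ### Covariant derivatives on open sets -/

section CovDeriv

variable {n k : ℕ} {U : Set (Model n)} {G G' : CoordTensor n 2} {x : Model n}

theorem dirDeriv_congr (hU : IsOpen U) (h : ∀ y ∈ U, G y = G' y) (hx : x ∈ U) (u v w : Model n) :
    dirDeriv G x u v w = dirDeriv G' x u v w := by
  unfold dirDeriv
  rw [(Filter.eventuallyEq_of_mem (hU.mem_nhds hx) fun y hy => by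
    show G y ![v, w] = G' y ![v, w]; rw [h y hy]).fderiv_eq]

theorem christoffel_congr (hU : IsOpen U) (h : ∀ y ∈ U, G y = G' y) (hx : x ∈ U) (v w : Model n) :
    christoffel G x v w = christoffel G' x v w := by
  simp only [christoffel, dirDeriv_congr hU h hx, h x hx]

/-- Locality: a field may be replaced by any expression valid on an open set before it is
differentiated. -/
theorem coordCovDeriv_congr {T T' : CoordTensor n k} (hU : IsOpen U) (h : ∀ y ∈ U, G y = G' y)
    (hT : ∀ y ∈ U, T y = T' y) (hx : x ∈ U) : coordCovDeriv G T x = coordCovDeriv G' T' x := by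
  funext v
  unfold coordCovDeriv
  rw [hT x hx, (Filter.eventuallyEq_of_mem (hU.mem_nhds hx) fun y hy => by
    show T y (Fin.init v) = T' y (Fin.init v); rw [hT y hy]).fderiv_eq]
  simp only [christoffel_congr hU h hx]

theorem coordCovDeriv_snoc (G : CoordTensor n 2) (T : CoordTensor n k) (x : Model n)
    (w : Fin k → Model n) (u : Model n) : coordCovDeriv G T x (Fin.snoc w u) =
      fderiv ℝ (fun y => T y w) x u - ∑ s, T x (update w s (christoffel G x u (w s))) := by
  simp [coordCovDeriv]

theorem coordCovDeriv_add {T T' : CoordTensor n k} (hU : IsOpen U) (hT : IsTensorOn U T)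
    (hT' : IsTensorOn U T') (hx : x ∈ U) (v : Fin (k + 1) → Model n) :
    coordCovDeriv G (fun y w => T y w + T' y w) x v =
      coordCovDeriv G T x v + coordCovDeriv G T' x v := by
  simp only [coordCovDeriv, Finset.sum_add_distrib]
  rw [fderiv_fun_add (hT.differentiableAt hU hx _) (hT'.differentiableAt hU hx _)]
  simp
  ring

theorem coordCovDeriv_sub {T T' : CoordTensor n k} (hU : IsOpen U) (hT : IsTensorOn U T)
    (hT' : IsTensorOn U T') (hx : x ∈ U) (v : Fin (k + 1) → Model n) :
    coordCovDeriv G (fun y w => T y w - T' y w) x v =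
      coordCovDeriv G T x v - coordCovDeriv G T' x v := by
  simp only [coordCovDeriv, Finset.sum_sub_distrib]
  rw [fderiv_fun_sub (hT.differentiableAt hU hx _) (hT'.differentiableAt hU hx _)]
  simp
  ring

theorem coordCovDeriv_const_smul {T : CoordTensor n k} (hU : IsOpen U) (hT : IsTensorOn U T)
    (c : ℝ) (hx : x ∈ U) (v : Fin (k + 1) → Model n) :
    coordCovDeriv G (fun y w => c • T y w) x v = c * coordCovDeriv G T x v := by
  simp only [coordCovDeriv]
  rw [fderiv_fun_const_smul (hT.differentiableAt hU hx _), ← Finset.smul_sum]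
  simp
  ring

/-- Covariant differentiation commutes with permutations of the slots. -/
theorem coordCovDeriv_perm (T : CoordTensor n k) (σ : Equiv.Perm (Fin k)) (w : Fin k → Model n)
    (u : Model n) : coordCovDeriv G (fun y v => T y fun i => v (σ i)) x (Fin.snoc w u) =
      coordCovDeriv G T x (Fin.snoc (fun i => w (σ i)) u) := by
  rw [coordCovDeriv_snoc, coordCovDeriv_snoc]
  congr 1
  rw [← Equiv.sum_comp σ]
  refine Finset.sum_congr rfl fun s _ => ?_
  congr 1
  ext i : 1
  by_cases hi : i = s
  · subst hi; simp
  · rw [update_of_ne hi, update_of_ne (σ.injective.ne hi)]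

/-- The metric is parallel. -/
theorem IsMetricOn.coordCovDeriv_self (hG : IsMetricOn U G) (hx : x ∈ U)
    (v : Fin 3 → Model n) : coordCovDeriv G G x v = 0 := by
  have h0 : (Fin.init v : Fin 2 → Model n) = ![v 0, v 1] := by ext i : 1; fin_cases i <;> rfl
  have := hG.dirDeriv_eq hx (v 2) (v 0) (v 1)
  unfold coordCovDeriv
  rw [h0, Fin.sum_univ_two, update_vec2_zero, update_vec2_one]
  exact sub_eq_zero.2 this

/-- The Leibniz rule with one moving slot: in `fderiv_comp` every other term has a zero vector in
some slot. -/
theorem IsTensorOn.fderiv_update {F : Type*} [NormedAddCommGroup F] [NormedSpace ℝ F]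
    {T : Model n → (Fin k → Model n) → F} (hT : IsTensorOn U T) (hU : IsOpen U) (hx : x ∈ U)
    (w : Fin k → Model n) (s : Fin k) {z : Model n → Model n} (hz : DifferentiableAt ℝ z x)
    (v : Model n) : fderiv ℝ (fun y => T y (update w s (z y))) x v =
      fderiv ℝ (fun y => T y (update w s (z x))) x v + T x (update w s (fderiv ℝ z x v)) := by
  have hw : HasFDerivAt (fun y => update w s (z y))
      ((ContinuousLinearMap.single ℝ (fun _ => Model n) s).comp (fderiv ℝ z x)) x := by
    rw [hasFDerivAt_pi']
    intro i
    by_cases hi : i = s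
    · subst hi
      simp only [update_self]
      exact hz.hasFDerivAt.congr_fderiv (by ext; simp)
    · simp only [ne_eq, hi, not_false_eq_true, update_of_ne]
      exact (hasFDerivAt_const (w i) x).congr_fderiv (by ext; simp [hi])
  have h := hT.fderiv_comp hU (φ := id) (w := fun y => update w s (z y)) differentiableAt_id
    hw.differentiableAt hx v
  simp only [id] at h
  rw [h, hw.fderiv]
  congr 1
  · simp
  · rw [Finset.sum_eq_single s]
    · simp
    · intro t _ ht
      convert hT.update_zero hx _ t
      simp [ht]
    · simp

end CovDeriv

/-! ### Curvature on open sets -/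

section Curvature

variable {n k : ℕ} {U : Set (Model n)} {G : CoordTensor n 2} {x : Model n}

/-- The field `∇_v (∇_u w)` for constant fields `u`, `w`, `v` in the slots `0`, `1`, `2`. -/
noncomputable def secondCov (G : CoordTensor n 2) (y : Model n) (v : Fin 3 → Model n) : Model n :=
  fderiv ℝ (fun y => christoffel G y (v 0) (v 1)) y (v 2) +
    christoffel G y (v 2) (christoffel G y (v 0) (v 1))

theorem IsMetricOn.secondCov_tensor (hG : IsMetricOn U G) : IsTensorOn U (secondCov G) := by
  have h1 := hG.christoffel_tensor.fderiv_snoc hG.isOpen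
  -- Inserting in slot `1` gives `Γ(v 0, Γ(v 2, v 1))`; exchanging slots `0` and `2` gives the
  -- nested term of `secondCov`.
  have h2 := (hG.christoffel_tensor.update_snoc hG.christoffel_tensor 1).perm (Equiv.swap 0 2)
  refine (h1.add h2).congr fun y hy => funext fun v => ?_
  unfold secondCov
  congr 1

theorem IsMetricOn.coordCurvOp_tensor (hG : IsMetricOn U G) :
    IsTensorOn U fun y (v : Fin 3 → Model n) => coordCurvOp G y (v 0) (v 1) (v 2) := by
  refine ((hG.secondCov_tensor.perm (Equiv.swap 1 2)).sub
    (hG.secondCov_tensor.perm (finRotate 3))).congr fun y _ => funext fun v => ?_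
  rfl

theorem IsMetricOn.differentiableAt_christoffel (hG : IsMetricOn U G) (hx : x ∈ U) (u w : Model n) :
    DifferentiableAt ℝ (fun y => christoffel G y u w) x :=
  hG.christoffel_tensor.differentiableAt hG.isOpen hx ![u, w]

/-- The second covariant derivative of a tensor field in terms of partial derivatives. -/
theorem coordCovDeriv_coordCovDeriv_snoc (hG : IsMetricOn U G) {T : CoordTensor n k}
    (hT : IsTensorOn U T) (hx : x ∈ U) (w : Fin k → Model n) (u v : Model n) :
    coordCovDeriv G (coordCovDeriv G T) x (Fin.snoc (Fin.snoc w u) v) =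
      fderiv ℝ (fun y => fderiv ℝ (fun y => T y w) y u) x v
      - ∑ s, (fderiv ℝ (fun y => T y (update w s (christoffel G x u (w s)))) x v +
          T x (update w s (fderiv ℝ (fun y => christoffel G y u (w s)) x v)))
      - (∑ s, (fderiv ℝ (fun y => T y (update w s (christoffel G x v (w s)))) x u -
          ∑ t, T x (update (update w s (christoffel G x v (w s))) t
            (christoffel G x u (update w s (christoffel G x v (w s)) t))))
        + coordCovDeriv G T x (Fin.snoc w (christoffel G x v u))) := by
  -- The derivative slot of `∇T` is split off: its correction involves only `christoffel G x v u`,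
  -- which is symmetric in `u` and `v` and drops out of commutators.
  rw [coordCovDeriv_snoc, Fin.sum_univ_castSucc]
  simp only [Fin.snoc_castSucc, Fin.snoc_last, Fin.update_snoc_last, ← Fin.snoc_update,
    coordCovDeriv_snoc]
  congr 1
  have hd : ∀ s, DifferentiableAt ℝ
      (fun y => T y (update w s (christoffel G y u (w s)))) x := fun s =>
    ((hT.contDiffOn (s := U) contDiffOn_id (contDiffOn_pi.2 fun i => by
      by_cases hi : i = s
      · subst hi; simpa using hG.christoffel_tensor.contDiffOn_apply ![u, w i]
      · simpa [hi] using contDiffOn_const) fun y hy => hy).contDiffAt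
      (hG.isOpen.mem_nhds hx)).differentiableAt (by simp)
  have hd1 : DifferentiableAt ℝ (fun y => fderiv ℝ (fun y => T y w) y u) x := by
    refine ((contDiffOn_fderiv_apply hG.isOpen (hT.contDiffOn_apply w) contDiffOn_id
      contDiffOn_const fun y hy => hy).contDiffAt (hG.isOpen.mem_nhds hx)).differentiableAt
      (by simp)
  rw [fderiv_fun_sub hd1 (DifferentiableAt.fun_sum fun s _ => hd s),
    fderiv_fun_sum fun s _ => hd s]
  simp only [_root_.sub_apply, _root_.sum_apply]
  congr 1
  refine Finset.sum_congr rfl fun s _ => ?_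
  rw [hT.fderiv_update hG.isOpen hx w s (hG.differentiableAt_christoffel hx u (w s))]

/-- The Ricci identity. -/
theorem ricci_identity (hG : IsMetricOn U G) {T : CoordTensor n k} (hT : IsTensorOn U T)
    (hx : x ∈ U) (w : Fin k → Model n) (u v : Model n) :
    coordCovDeriv G (coordCovDeriv G T) x (Fin.snoc (Fin.snoc w u) v) =
      coordCovDeriv G (coordCovDeriv G T) x (Fin.snoc (Fin.snoc w v) u) -
        ∑ s, T x (update w s (coordCurvOp G x u v (w s))) := by
  rw [coordCovDeriv_coordCovDeriv_snoc hG hT hx, coordCovDeriv_coordCovDeriv_snoc hG hT hx,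
    fderiv_fderiv_comm hG.isOpen (hT.contDiffOn_apply w) hx u v, hG.christoffel_comm hx u v]
  simp only [Finset.sum_add_distrib, Finset.sum_sub_distrib]
  have hR : ∀ s, T x (update w s (coordCurvOp G x u v (w s))) =
      T x (update w s (fderiv ℝ (fun y => christoffel G y u (w s)) x v)) +
        T x (update w s (christoffel G x v (christoffel G x u (w s)))) -
      (T x (update w s (fderiv ℝ (fun y => christoffel G y v (w s)) x u)) +
        T x (update w s (christoffel G x u (christoffel G x v (w s))))) := fun s => by
    simp only [← hT.slot_apply hx, ← map_add, ← map_sub]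
    rfl
  -- Terms with `s ≠ t` agree after exchanging the two summation indices. The diagonal leaves the
  -- quadratic part of the curvature.
  have hD : ∑ s, ∑ t, T x (update (update w s (christoffel G x v (w s))) t
            (christoffel G x u (update w s (christoffel G x v (w s)) t))) -
      ∑ s, ∑ t, T x (update (update w s (christoffel G x u (w s))) t
            (christoffel G x v (update w s (christoffel G x u (w s)) t))) =
      ∑ s, T x (update w s (christoffel G x u (christoffel G x v (w s)))) -
        ∑ s, T x (update w s (christoffel G x v (christoffel G x u (w s)))) := by
    conv_lhs => enter [2]; rw [Finset.sum_comm]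
    rw [← Finset.sum_sub_distrib, ← Finset.sum_sub_distrib]
    refine Finset.sum_congr rfl fun s _ => ?_
    rw [← Finset.sum_sub_distrib, Finset.sum_eq_single s]
    · simp
    · intro t _ ht
      rw [update_of_ne ht, update_of_ne ht.symm, update_comm ht, sub_self]
    · simp
  simp only [hR, Finset.sum_add_distrib, Finset.sum_sub_distrib]
  linarith

end Curvature

/-! ### Naturality under local diffeomorphisms -/

section Naturality

variable {n k : ℕ} {U V : Set (Model n)} {G G' : CoordTensor n 2} {φ : Model n → Model n}
  {x : Model n}

/-- `φ` is a smooth map from `V` to `U` which pulls back the metric `G` to the metric `G'`. -/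
structure IsIsometryOn (φ : Model n → Model n) (V U : Set (Model n)) (G' G : CoordTensor n 2) :
    Prop where
  source : IsMetricOn V G'
  target : IsMetricOn U G
  mapsTo : MapsTo φ V U
  smooth : ContDiffOn ℝ ∞ φ V
  pullback : ∀ x ∈ V, ∀ v, G' x v = G (φ x) fun i => fderiv ℝ φ x (v i)

namespace IsIsometryOn

variable (h : IsIsometryOn φ V U G' G)
include h

theorem differentiableAt (hx : x ∈ V) : DifferentiableAt ℝ φ x :=
  (h.smooth.contDiffAt (h.source.isOpen.mem_nhds hx)).differentiableAt (by simp)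

theorem contDiffOn_fderiv (v : Model n) : ContDiffOn ℝ ∞ (fun y => fderiv ℝ φ y v) V :=
  contDiffOn_fderiv_apply h.source.isOpen h.smooth contDiffOn_id contDiffOn_const fun _ hy => hy

/-- A pull-back that is positive definite forces the derivative to be injective, hence bijective
because the dimensions agree. -/
theorem surjective (hx : x ∈ V) : Surjective (fderiv ℝ φ x) := by
  refine LinearMap.surjective_of_injective (f := (fderiv ℝ φ x : Model n →ₗ[ℝ] Model n)) ?_
  refine (injective_iff_map_eq_zero _).2 fun a ha => ?_
  by_contra hne
  have h1 := h.source.pos x hx a hne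
  rw [h.pullback x hx] at h1
  have ha' : fderiv ℝ φ x a = 0 := ha
  have h2 := h.target.tensor.update_zero (h.mapsTo hx) ![0, 0] 0
  have h3 : (fun i => fderiv ℝ φ x (![a, a] i)) = update ![0, 0] 0 (0 : Model n) := by
    ext i : 1; fin_cases i <;> simp [ha']
  rw [h3, h2] at h1
  exact h1.false

theorem pullback_pair (hx : x ∈ V) (a b : Model n) :
    G' x ![a, b] = G (φ x) ![fderiv ℝ φ x a, fderiv ℝ φ x b] := by
  rw [h.pullback x hx]
  congr 1
  ext i : 1
  fin_cases i <;> rfl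

theorem fderiv_pullback {T : CoordTensor n k} (hT : IsTensorOn U T) (hx : x ∈ V)
    (v : Fin k → Model n) (u : Model n) :
    fderiv ℝ (fun y => T (φ y) fun i => fderiv ℝ φ y (v i)) x u =
      fderiv ℝ (fun y => T y fun i => fderiv ℝ φ x (v i)) (φ x) (fderiv ℝ φ x u) +
        ∑ s, T (φ x) (update (fun i => fderiv ℝ φ x (v i)) s
          (fderiv ℝ (fun y => fderiv ℝ φ y (v s)) x u)) := by
  have hd : ∀ i, DifferentiableAt ℝ (fun y => fderiv ℝ φ y (v i)) x := fun i =>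
    ((h.contDiffOn_fderiv (v i)).contDiffAt (h.source.isOpen.mem_nhds hx)).differentiableAt
      (by simp)
  have hw := hasFDerivAt_pi.2 fun i => (hd i).hasFDerivAt
  rw [hT.fderiv_comp h.target.isOpen (w := fun y i => fderiv ℝ φ y (v i)) (h.differentiableAt hx)
    hw.differentiableAt (h.mapsTo hx), hw.fderiv]
  rfl

theorem dirDeriv_pullback (hx : x ∈ V) (u v w : Model n) :
    dirDeriv G' x u v w =
      dirDeriv G (φ x) (fderiv ℝ φ x u) (fderiv ℝ φ x v) (fderiv ℝ φ x w) +
        G (φ x) ![fderiv ℝ (fun y => fderiv ℝ φ y v) x u, fderiv ℝ φ x w] +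
        G (φ x) ![fderiv ℝ φ x v, fderiv ℝ (fun y => fderiv ℝ φ y w) x u] := by
  unfold dirDeriv
  rw [(Filter.eventuallyEq_of_mem (h.source.isOpen.mem_nhds hx) fun y hy =>
    h.pullback y hy ![v, w]).fderiv_eq, h.fderiv_pullback h.target.tensor hx, Fin.sum_univ_two]
  have e : (fun i => fderiv ℝ φ x (![v, w] i)) = ![fderiv ℝ φ x v, fderiv ℝ φ x w] := by
    ext i : 1; fin_cases i <;> rfl
  simp only [e, update_vec2_zero, update_vec2_one, add_assoc]
  rfl

/-- The transformation law of the Christoffel symbols. -/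
theorem fderiv_christoffel (hx : x ∈ V) (v w : Model n) :
    fderiv ℝ φ x (christoffel G' x v w) =
      fderiv ℝ (fun y => fderiv ℝ φ y w) x v +
        christoffel G (φ x) (fderiv ℝ φ x v) (fderiv ℝ φ x w) := by
  refine h.target.ext (h.mapsTo hx) fun z => ?_
  obtain ⟨u, rfl⟩ := h.surjective hx z
  have hy := h.mapsTo hx
  have h1 := h.source.two_mul_christoffel hx u v w
  rw [h.pullback_pair hx, h.dirDeriv_pullback hx, h.dirDeriv_pullback hx, h.dirDeriv_pullback hx]
    at h1
  have h2 := h.target.two_mul_christoffel hy (fderiv ℝ φ x u) (fderiv ℝ φ x v) (fderiv ℝ φ x w)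
  -- By symmetry of the second derivative of `φ`, four of the six correction terms in the Koszul
  -- formula cancel in pairs; the other two coincide.
  have hc := fun a b => fderiv_fderiv_comm h.source.isOpen h.smooth hx a b
  rw [hc u v, hc u w, hc v w] at h1
  have h3 := LinearMap.map_add₂ (h.target.tensor.bilin hy) (fderiv ℝ (fun y => fderiv ℝ φ y w) x v)
    (christoffel G (φ x) (fderiv ℝ φ x v) (fderiv ℝ φ x w)) (fderiv ℝ φ x u)
  simp only [IsTensorOn.bilin_apply] at h3
  rw [h3]
  have := h.target.symm _ hy (fderiv ℝ φ x w) (fderiv ℝ (fun y => fderiv ℝ φ y v) x u)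
  linarith

/-- Covariant differentiation is natural. -/
theorem coordCovDeriv {T T' : CoordTensor n k} (hT : IsTensorOn U T)
    (hTT : ∀ x ∈ V, ∀ v, T' x v = T (φ x) fun i => fderiv ℝ φ x (v i)) (hx : x ∈ V)
    (v : Fin (k + 1) → Model n) :
    coordCovDeriv G' T' x v = coordCovDeriv G T (φ x) fun i => fderiv ℝ φ x (v i) := by
  unfold RicciDrift.coordCovDeriv
  rw [(Filter.eventuallyEq_of_mem (h.source.isOpen.mem_nhds hx) fun y hy =>
    hTT y hy (Fin.init v)).fderiv_eq, h.fderiv_pullback hT hx]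
  have e : (Fin.init fun i => fderiv ℝ φ x (v i)) = fun i => fderiv ℝ φ x (Fin.init v i) := rfl
  rw [e, add_sub_assoc, sub_eq_add_neg (fderiv ℝ _ _ _) (∑ s, _)]
  congr 1
  rw [← Finset.sum_sub_distrib, ← Finset.sum_neg_distrib]
  -- Slot by slot, the second derivative of `φ` cancels the inhomogeneous term of
  -- `fderiv_christoffel`.
  refine Finset.sum_congr rfl fun s _ => ?_
  have e2 : (fun i => fderiv ℝ φ x (update (Fin.init v) s
      (christoffel G' x (v (Fin.last k)) (v s.castSucc)) i)) =
      update (fun i => fderiv ℝ φ x (Fin.init v i)) s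
        (fderiv ℝ φ x (christoffel G' x (v (Fin.last k)) (v s.castSucc))) := by
    ext i : 1
    by_cases hi : i = s
    · subst hi; simp
    · simp [hi]
  rw [hTT x hx, e2, h.fderiv_christoffel hx]
  simp only [← hT.slot_apply (h.mapsTo hx), map_add]
  simp only [Fin.init]
  ring

/-- The curvature operator is natural. -/
theorem coordCurvOp (hx : x ∈ V) (u v w : Model n) :
    fderiv ℝ φ x (coordCurvOp G' x u v w) =
      coordCurvOp G (φ x) (fderiv ℝ φ x u) (fderiv ℝ φ x v) (fderiv ℝ φ x w) := by
  refine ext_inner_right ℝ fun z => ?_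
  -- Instead of differentiating the transformation law of the Christoffel symbols, the Ricci
  -- identities of a `1`-form and of its pull-back are compared, second covariant derivatives being
  -- natural. The Euclidean product only serves to supply enough `1`-forms.
  set T : CoordTensor n 1 := fun _ v => inner ℝ (v 0) z with hTd
  set T' : CoordTensor n 1 := fun x v => T (φ x) fun i => fderiv ℝ φ x (v i) with hTd'
  have hT : IsTensorOn U T := by
    refine IsTensorOn.of_update (fun x _ v i c a b => ?_) ?_
    · rw [Subsingleton.elim i 0]
      simp [hTd, inner_add_left, inner_smul_left]
    · exact (ContDiff.inner ℝ (by fun_prop) contDiff_const).contDiffOn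
  have hT' : IsTensorOn V T' := by
    refine IsTensorOn.of_update (fun x _ v i c a b => ?_) ?_
    · rw [Subsingleton.elim i 0]
      simp [hTd, hTd', inner_add_left, inner_smul_left]
    · refine ContDiffOn.inner ℝ ?_ contDiffOn_const
      exact contDiffOn_fderiv_apply h.source.isOpen h.smooth contDiffOn_fst
        (ContDiff.contDiffOn (by fun_prop)) fun z hz => hz.1
  have h2 := fun a b c => h.coordCovDeriv (hT.coordCovDeriv h.target)
    (fun y hy v => h.coordCovDeriv hT (T' := T') (fun _ _ _ => rfl) hy v) hx
    (Fin.snoc (Fin.snoc ![a] b) c)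
  have e : ∀ a b c : Model n, (fun i => fderiv ℝ φ x
      ((Fin.snoc (Fin.snoc ![a] b : Fin 2 → Model n) c : Fin 3 → Model n) i)) =
      Fin.snoc (Fin.snoc ![fderiv ℝ φ x a] (fderiv ℝ φ x b)) (fderiv ℝ φ x c) := fun a b c => by
    ext i : 1; fin_cases i <;> rfl
  simp only [e] at h2
  have r1 := ricci_identity h.source hT' hx ![w] u v
  have r2 := ricci_identity h.target hT (h.mapsTo hx) ![fderiv ℝ φ x w] (fderiv ℝ φ x u)
    (fderiv ℝ φ x v)
  rw [← h2, ← h2, r1] at r2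
  simp only [Fin.sum_univ_one, update_vec1, sub_right_inj] at r2
  exact r2

end IsIsometryOn

end Naturality

/-! ### Contractions -/

section Contraction

variable {n k : ℕ} {U V : Set (Model n)} {G G' : CoordTensor n 2} {T : CoordTensor n (k + 2)}
  {x : Model n}

/-- The contraction of the first two slots with respect to the metric `G`. -/
noncomputable def contr (G : CoordTensor n 2) (T : CoordTensor n (k + 2)) : CoordTensor n k :=
  fun x v => ∑ i, ∑ j, invGram (fun a b => G x ![a, b]) i j *
    T x (Fin.cons (coordVec i) (Fin.cons (coordVec j) v))

/-- The first two slots of a tensor field, as a bilinear map. -/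
noncomputable def IsTensorOn.bilinCons (hT : IsTensorOn U T) (hx : x ∈ U) (v : Fin k → Model n) :
    Model n →ₗ[ℝ] Model n →ₗ[ℝ] ℝ :=
  LinearMap.mk₂ ℝ (fun a b => T x (Fin.cons a (Fin.cons b v)))
    (fun a b c => by
      have := (hT.slot hx (Fin.cons 0 (Fin.cons c v)) 0).map_add a b
      simpa only [slot_apply, Fin.update_cons_zero] using this)
    (fun r a c => by
      have := (hT.slot hx (Fin.cons 0 (Fin.cons c v)) 0).map_smul r a
      simpa only [slot_apply, Fin.update_cons_zero] using this)
    (fun a b c => by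
      have := (hT.slot hx (Fin.cons a (Fin.cons 0 v)) (Fin.succ 0)).map_add b c
      simpa only [slot_apply, ← Fin.cons_update, Fin.update_cons_zero] using this)
    (fun r a c => by
      have := (hT.slot hx (Fin.cons a (Fin.cons 0 v)) (Fin.succ 0)).map_smul r c
      simpa only [slot_apply, ← Fin.cons_update, Fin.update_cons_zero] using this)

theorem IsTensorOn.bilinCons_apply (hT : IsTensorOn U T) (hx : x ∈ U) (v : Fin k → Model n)
    (a b : Model n) : hT.bilinCons hx v a b = T x (Fin.cons a (Fin.cons b v)) := rfl

theorem contr_eq_sum_dualVec (hT : IsTensorOn U T) (hx : x ∈ U) (v : Fin k → Model n) :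
    contr G T x v = ∑ j, T x (Fin.cons (dualVec (fun a b => G x ![a, b]) j)
      (Fin.cons (coordVec j) v)) :=
  sum_invGram_mul (hT.bilinCons hx v) _

/-- The freedom in the choice of dual families gives both the naturality of contractions and their
evaluation in orthonormal frames. -/
theorem contr_eq_sum (hG : IsMetricOn U G) (hT : IsTensorOn U T) (hx : x ∈ U) {ι : Type*}
    [Fintype ι] {a b : ι → Model n} (hab : ∀ w, ∑ i, G x ![a i, w] • b i = w)
    (v : Fin k → Model n) :
    contr G T x v = ∑ i, T x (Fin.cons (a i) (Fin.cons (b i) v)) := by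
  rw [contr_eq_sum_dualVec hT hx]
  exact sum_dualVec_eq (B := hG.tensor.bilin hx) (hG.symm x hx) (hG.pos x hx) hab
    (hT.bilinCons hx v)

theorem contr_eq_sum_orthonormal (hG : IsMetricOn U G) (hT : IsTensorOn U T) (hx : x ∈ U)
    {e : Fin n → Model n} (he : ∀ i j, G x ![e i, e j] = if i = j then 1 else 0)
    (v : Fin k → Model n) : contr G T x v = ∑ i, T x (Fin.cons (e i) (Fin.cons (e i) v)) :=
  contr_eq_sum hG hT hx (sum_orthonormal (B := hG.tensor.bilin hx) he) v

theorem IsTensorOn.contr (hT : IsTensorOn U T) (hG : IsMetricOn U G) :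
    IsTensorOn U (contr G T) := by
  refine IsTensorOn.of_update (fun x hx v i c a b => ?_) ?_
  · simp only [RicciDrift.contr, Fin.cons_update, hT.update_lin hx, smul_eq_mul, mul_add,
      Finset.sum_add_distrib, Finset.mul_sum]
    congr 1
    refine Finset.sum_congr rfl fun i _ => Finset.sum_congr rfl fun j _ => ?_
    ring
  · unfold RicciDrift.contr
    refine ContDiffOn.sum fun i _ => ContDiffOn.sum fun j _ => ContDiffOn.mul
      ((hG.contDiffOn_invGram i j).comp contDiffOn_fst fun z hz => hz.1)
      (hT.contDiffOn contDiffOn_fst (ContDiff.contDiffOn (contDiff_pi.2 fun l => ?_))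
        fun z hz => hz.1)
    refine Fin.cases ?_ (fun l => Fin.cases ?_ (fun l => ?_) l) l
    · simpa using contDiff_const
    · simpa using contDiff_const
    · simp only [Fin.cons_succ]; fun_prop

/-- The derivative of an isometry carries dual families to dual families. -/
theorem IsIsometryOn.contr {φ : Model n → Model n} (h : IsIsometryOn φ V U G' G)
    {T' : CoordTensor n (k + 2)} (hT : IsTensorOn U T) (hT' : IsTensorOn V T')
    (hTT : ∀ x ∈ V, ∀ v, T' x v = T (φ x) fun i => fderiv ℝ φ x (v i)) (hx : x ∈ V)
    (v : Fin k → Model n) :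
    contr G' T' x v = contr G T (φ x) fun i => fderiv ℝ φ x (v i) := by
  rw [contr_eq_sum_dualVec hT' hx]
  rw [contr_eq_sum h.target hT (h.mapsTo hx)
    (a := fun j => fderiv ℝ φ x (dualVec (fun a b => G' x ![a, b]) j))
    (b := fun j => fderiv ℝ φ x (coordVec j))]
  · refine Finset.sum_congr rfl fun j _ => ?_
    rw [hTT x hx]
    congr 1
    ext i : 1
    refine Fin.cases ?_ (fun i => Fin.cases ?_ (fun i => ?_) i) i <;> simp
  · intro w
    obtain ⟨w, rfl⟩ := h.surjective hx w
    simp only [← h.pullback_pair hx, h.source.dualVec_left hx]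
    conv_rhs => rw [← sum_coordVec w]
    simp

/-- Covariant differentiation commutes with contractions. -/
theorem coordCovDeriv_contr (hG : IsMetricOn U G) (hT : IsTensorOn U T) (hx : x ∈ U)
    (w : Fin k → Model n) (u : Model n) :
    coordCovDeriv G (contr G T) x (Fin.snoc w u) =
      contr G (k := k + 1) (coordCovDeriv G T) x (Fin.snoc w u) := by
  set s : Fin n → Model n → Model n := fun j y => dualVec (fun a b => G y ![a, b]) j with hs
  have hsd : ∀ j, DifferentiableAt ℝ (s j) x := fun j =>
    ((hG.contDiffOn_dualVec j).contDiffAt (hG.isOpen.mem_nhds hx)).differentiableAt (by simp)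
  have hderiv : fderiv ℝ (fun y => contr G T y w) x u =
      ∑ j, (fderiv ℝ (fun y => T y (Fin.cons (s j x) (Fin.cons (coordVec j) w))) x u +
        T x (Fin.cons (fderiv ℝ (s j) x u) (Fin.cons (coordVec j) w))) := by
    rw [(Filter.eventuallyEq_of_mem (hG.isOpen.mem_nhds hx) fun y hy =>
      contr_eq_sum_dualVec hT hy w).fderiv_eq, fderiv_fun_sum, _root_.sum_apply]
    · refine Finset.sum_congr rfl fun j _ => ?_
      have := hT.fderiv_update hG.isOpen hx (Fin.cons 0 (Fin.cons (coordVec j) w)) 0 (hsd j) u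
      simpa only [Fin.update_cons_zero] using this
    · intro j _
      refine ((hT.contDiffOn (s := U) contDiffOn_id (contDiffOn_pi.2 fun i => ?_)
        fun y hy => hy).contDiffAt (hG.isOpen.mem_nhds hx)).differentiableAt (by simp)
      refine Fin.cases ?_ (fun i => ?_) i
      · simpa using hG.contDiffOn_dualVec j
      · simpa using contDiffOn_const
  -- The varying dual vectors supply exactly the Christoffel corrections of the two contracted
  -- slots.
  have hkey : ∑ j, T x (Fin.cons (fderiv ℝ (s j) x u) (Fin.cons (coordVec j) w)) =
      - ∑ j, (T x (Fin.cons (christoffel G x u (s j x)) (Fin.cons (coordVec j) w)) +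
        T x (Fin.cons (s j x) (Fin.cons (christoffel G x u (coordVec j)) w))) := by
    set C := hT.bilinCons hx w with hC
    -- This follows by differentiating the constant function `G(s j, z) = z j` and using that the
    -- connection is metric.
    have hs' : ∀ j, fderiv ℝ (s j) x u = -christoffel G x u (s j x) -
        ∑ i, (christoffel G x u (coordVec i)) j • s i x := by
      intro j
      refine hG.ext hx fun z => ?_
      have h1 : fderiv ℝ (fun y => G y ![s j y, z]) x u = 0 := by
        rw [(Filter.eventuallyEq_of_mem (hG.isOpen.mem_nhds hx) fun y hy =>
          hG.dualVec_left hy j z).fderiv_eq]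
        simp
      have h2 := hG.tensor.fderiv_update hG.isOpen hx ![0, z] 0 (hsd j) u
      simp only [update_vec2_zero] at h2
      rw [h1] at h2
      have h3 := hG.dirDeriv_eq hx u (s j x) z
      unfold dirDeriv at h3
      rw [h3] at h2
      have h4 : G x ![s j x, christoffel G x u z] =
          ∑ i, (christoffel G x u (coordVec i)) j * G x ![s i x, z] := by
        simp only [hs, hG.dualVec_left hx]
        have : christoffel G x u z = ∑ i, z i • christoffel G x u (coordVec i) := by
          have h := hG.christoffel_tensor.bilin_apply hx u z
          rw [← sum_coordVec z, map_sum] at h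
          simp only [map_smul, IsTensorOn.bilin_apply] at h
          rw [sum_coordVec] at h
          exact h.symm
        rw [this]
        simp [mul_comm]
      have h5 : hG.tensor.bilin hx (-christoffel G x u (s j x) -
          ∑ i, (christoffel G x u (coordVec i)) j • s i x) z =
          - G x ![christoffel G x u (s j x), z] -
            ∑ i, (christoffel G x u (coordVec i)) j * G x ![s i x, z] := by
        simp only [map_sub, map_neg, map_sum, map_smul, LinearMap.sub_apply, LinearMap.neg_apply,
          LinearMap.sum_apply, LinearMap.smul_apply, IsTensorOn.bilin_apply, smul_eq_mul]
      rw [IsTensorOn.bilin_apply] at h5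
      rw [h5]
      linarith
    have h6 : ∀ j, T x (Fin.cons (fderiv ℝ (s j) x u) (Fin.cons (coordVec j) w)) =
        -C (christoffel G x u (s j x)) (coordVec j) -
          ∑ i, (christoffel G x u (coordVec i)) j * C (s i x) (coordVec j) := fun j => by
      rw [← hT.bilinCons_apply hx, hs' j]
      simp only [map_sub, map_neg, map_sum, map_smul, LinearMap.sub_apply, LinearMap.neg_apply,
        LinearMap.sum_apply, LinearMap.smul_apply, smul_eq_mul, ← hC]
    -- Summed over `i`, this moves the second correction from the dual vectors onto the coordinate
    -- vectors.
    have h7 : ∀ i, C (s i x) (christoffel G x u (coordVec i)) =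
        ∑ j, (christoffel G x u (coordVec i)) j * C (s i x) (coordVec j) := fun i => by
      conv_lhs => rw [← sum_coordVec (christoffel G x u (coordVec i))]
      simp only [map_sum, map_smul, smul_eq_mul]
    simp only [h6, Finset.sum_sub_distrib, Finset.sum_add_distrib, Finset.sum_neg_distrib, neg_add]
    rw [sub_eq_add_neg, Finset.sum_comm]
    simp only [← h7]
    rfl
  rw [contr_eq_sum_dualVec (hT.coordCovDeriv hG) hx, coordCovDeriv_snoc, hderiv]
  have hc : ∀ a b : Model n, (Fin.cons a (Fin.cons b (Fin.snoc w u : Fin (k + 1) → Model n) :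
      Fin (k + 2) → Model n) : Fin (k + 3) → Model n) =
      Fin.snoc (Fin.cons a (Fin.cons b w)) u := fun a b => by
    rw [Fin.cons_snoc_eq_snoc_cons, Fin.cons_snoc_eq_snoc_cons]
  simp only [hc, coordCovDeriv_snoc]
  simp only [contr_eq_sum_dualVec hT hx]
  rw [Finset.sum_add_distrib, hkey, Finset.sum_comm, Finset.sum_sub_distrib, add_sub_assoc]
  congr 1
  rw [← Finset.sum_neg_distrib, ← Finset.sum_sub_distrib, ← Finset.sum_neg_distrib]
  refine Finset.sum_congr rfl fun j _ => ?_
  rw [Fin.sum_univ_succ, Fin.sum_univ_succ]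
  simp only [Fin.cons_zero, Fin.cons_succ, Fin.update_cons_zero, ← Fin.cons_update]
  ring

end Contraction

/-! ### Inheritance of symmetries by covariant derivatives, and the symmetries of curvature. -/

section

variable {n k : ℕ} {U : Set (Model n)} {G : CoordTensor n 2} {x : Model n}

/-- Symmetries of a tensor field persist under covariant differentiation. -/
theorem coordCovDeriv_symmetry (hG : IsMetricOn U G) {T : CoordTensor n k} (hT : IsTensorOn U T)
    (σ : Equiv.Perm (Fin k)) (c : ℝ) (h : ∀ y ∈ U, ∀ v, (T y fun j => v (σ j)) = c * T y v)
    (hx : x ∈ U) {w w' : Fin (k + 1) → Model n}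
    (hw : w' = Fin.snoc (fun j => w (σ j).castSucc) (w (Fin.last k))) :
    coordCovDeriv G T x w' = c * coordCovDeriv G T x w := by
  obtain ⟨v, u, rfl⟩ : ∃ v u, w = Fin.snoc v u := ⟨_, _, (Fin.snoc_init_self w).symm⟩
  simp only [Fin.snoc_castSucc, Fin.snoc_last] at hw
  rw [hw, ← coordCovDeriv_perm, ← coordCovDeriv_const_smul hG.isOpen hT c hx]
  exact congrFun (coordCovDeriv_congr hG.isOpen (fun _ _ => rfl)
    (fun y hy => funext fun v => h y hy v) hx) _

/-- Cyclic identities of a tensor field persist under covariant differentiation. -/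
theorem coordCovDeriv_cyclic (hG : IsMetricOn U G) {T : CoordTensor n k} (hT : IsTensorOn U T)
    (σ τ : Equiv.Perm (Fin k))
    (h : ∀ y ∈ U, ∀ v, T y v + (T y fun j => v (σ j)) + (T y fun j => v (τ j)) = 0)
    (hx : x ∈ U) {w w' w'' : Fin (k + 1) → Model n}
    (hw' : w' = Fin.snoc (fun j => w (σ j).castSucc) (w (Fin.last k)))
    (hw'' : w'' = Fin.snoc (fun j => w (τ j).castSucc) (w (Fin.last k))) :
    coordCovDeriv G T x w + coordCovDeriv G T x w' + coordCovDeriv G T x w'' = 0 := by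
  obtain ⟨v, u, rfl⟩ : ∃ v u, w = Fin.snoc v u := ⟨_, _, (Fin.snoc_init_self w).symm⟩
  simp only [Fin.snoc_castSucc, Fin.snoc_last] at hw' hw''
  rw [hw', hw'', ← coordCovDeriv_perm, ← coordCovDeriv_perm,
    ← coordCovDeriv_add hG.isOpen hT (hT.perm σ) hx,
    ← coordCovDeriv_add hG.isOpen (hT.add (hT.perm σ)) (hT.perm τ) hx]
  refine (congrFun (coordCovDeriv_congr (G' := G) (T' := fun _ _ => 0) hG.isOpen (fun _ _ => rfl)
    (fun y hy => funext fun v => h y hy v) hx) _).trans ?_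
  simp [coordCovDeriv]

/-! ### Symmetries of the curvature operator -/

theorem coordCurvOp_swap (G : CoordTensor n 2) (x u v w : Model n) :
    coordCurvOp G x v u w = -coordCurvOp G x u v w := by
  unfold coordCurvOp; abel

/-- The first Bianchi identity: symmetry of the Christoffel symbols holds near `x`, hence also for
their derivatives, and then all terms cancel in pairs. -/
theorem IsMetricOn.coordCurvOp_cyclic (hG : IsMetricOn U G) (hx : x ∈ U) (u v w : Model n) :
    coordCurvOp G x u v w + coordCurvOp G x v w u + coordCurvOp G x w u v = 0 := by
  have h : ∀ a b, (fun y => christoffel G y a b) =ᶠ[nhds x] fun y => christoffel G y b a :=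
    fun a b => Filter.eventuallyEq_of_mem (hG.isOpen.mem_nhds hx) fun y hy =>
      hG.christoffel_comm hy a b
  unfold coordCurvOp
  rw [(h v u).fderiv_eq, (h w u).fderiv_eq, (h w v).fderiv_eq, hG.christoffel_comm hx v u,
    hG.christoffel_comm hx w u, hG.christoffel_comm hx w v]
  abel

/-- The covariant derivative of the curvature operator: `(∇_c R)(a, b) w`. -/
noncomputable def covCurvOp (G : CoordTensor n 2) (x a b w c : Model n) : Model n :=
  fderiv ℝ (fun y => coordCurvOp G y a b w) x c + christoffel G x c (coordCurvOp G x a b w) -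
    coordCurvOp G x (christoffel G x c a) b w - coordCurvOp G x a (christoffel G x c b) w -
    coordCurvOp G x a b (christoffel G x c w)

theorem IsMetricOn.differentiableAt_coordCurvOp (hG : IsMetricOn U G) (hx : x ∈ U)
    (a b w : Model n) : DifferentiableAt ℝ (fun y => coordCurvOp G y a b w) x :=
  hG.coordCurvOp_tensor.differentiableAt hG.isOpen hx ![a, b, w]

/-- The Leibniz rule for a `1`-tensor field composed with the curvature operator. -/
theorem coordCovDeriv_comp_curvOp (hG : IsMetricOn U G) {T : CoordTensor n 1}
    (hT : IsTensorOn U T) (hx : x ∈ U) (a b w c : Model n) :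
    coordCovDeriv G (fun y (v : Fin 3 → Model n) => T y ![coordCurvOp G y (v 0) (v 1) (v 2)]) x
      ![a, b, w, c] =
      coordCovDeriv G T x ![coordCurvOp G x a b w, c] + T x ![covCurvOp G x a b w c] := by
  have e3 : (![a, b, w, c] : Fin 4 → Model n) = Fin.snoc ![a, b, w] c := by
    ext i : 1; fin_cases i <;> rfl
  have e1 : ∀ z, (![z, c] : Fin 2 → Model n) = Fin.snoc ![z] c := fun z => by
    ext i : 1; fin_cases i <;> rfl
  have h := hT.fderiv_update hG.isOpen hx ![0] 0 (hG.differentiableAt_coordCurvOp hx a b w) c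
  simp only [update_vec1] at h
  rw [e3, e1, coordCovDeriv_snoc, coordCovDeriv_snoc]
  simp only [Fin.sum_univ_three, Fin.sum_univ_one, update_vec3_zero, update_vec3_one,
    update_vec3_two, update_vec1]
  simp only [Matrix.cons_val_zero, Matrix.cons_val_one, Matrix.cons_val]
  rw [h]
  unfold covCurvOp
  simp only [← hT.lin_apply hx, map_sub, map_add]
  ring

/-- The Riemann curvature tensor on an open set. -/
noncomputable def curvTensor (G : CoordTensor n 2) : CoordTensor n 4 := fun x v =>
  G x ![coordCurvOp G x (v 0) (v 1) (v 2), v 3]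

theorem curvTensor_apply (G : CoordTensor n 2) (x a b c d : Model n) :
    curvTensor G x ![a, b, c, d] = G x ![coordCurvOp G x a b c, d] := rfl

theorem IsMetricOn.curvTensor (hG : IsMetricOn U G) : IsTensorOn U (curvTensor G) := by
  have hR := hG.coordCurvOp_tensor
  refine IsTensorOn.of_update (fun x hx v i c a b => ?_) ?_
  · unfold RicciDrift.curvTensor
    have e0 := hR.update_lin hx ![0, v 1, v 2] 0 c a b
    have e1 := hR.update_lin hx ![v 0, 0, v 2] 1 c a b
    have e2 := hR.update_lin hx ![v 0, v 1, 0] 2 c a b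
    simp only [update_vec3_zero, update_vec3_one, update_vec3_two] at e0 e1 e2
    simp at e0 e1 e2
    simp only [← hG.tensor.bilin_apply hx]
    fin_cases i <;> simp [e0, e1, e2, -IsTensorOn.bilin_apply]
  · refine hG.tensor.contDiffOn contDiffOn_fst (contDiffOn_pi.2 fun i => ?_) fun z hz => hz.1
    fin_cases i
    · exact hR.contDiffOn (w := fun z : Model n × (Fin 4 → Model n) => ![z.2 0, z.2 1, z.2 2])
        contDiffOn_fst (contDiffOn_pi.2 fun i => by fin_cases i <;> simp <;> fun_prop)
        fun z hz => hz.1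
    · simp only [Fin.mk_one, Matrix.cons_val_one, Matrix.cons_val_fin_one]; fun_prop

theorem curvTensor_swap_left (hG : IsMetricOn U G) (hx : x ∈ U) (a b c d : Model n) :
    curvTensor G x ![b, a, c, d] = -curvTensor G x ![a, b, c, d] := by
  simp only [curvTensor_apply, coordCurvOp_swap G x a b, ← hG.tensor.bilin_apply hx, map_neg,
    LinearMap.neg_apply]

theorem curvTensor_cyclic (hG : IsMetricOn U G) (hx : x ∈ U) (a b c d : Model n) :
    curvTensor G x ![a, b, c, d] + curvTensor G x ![b, c, a, d] + curvTensor G x ![c, a, b, d] =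
      0 := by
  simp only [curvTensor_apply, ← hG.tensor.bilin_apply hx, ← LinearMap.add_apply, ← map_add,
    hG.coordCurvOp_cyclic hx, map_zero, LinearMap.zero_apply]

/-- The Ricci identity for the metric itself, whose covariant derivatives vanish. -/
theorem curvTensor_swap_right (hG : IsMetricOn U G) (hx : x ∈ U) (a b c d : Model n) :
    curvTensor G x ![a, b, d, c] = -curvTensor G x ![a, b, c, d] := by
  have h := ricci_identity hG hG.tensor hx ![c, d] a b
  have h0 : ∀ v, coordCovDeriv G (coordCovDeriv G G) x v = 0 := fun v => by
    have : coordCovDeriv G (coordCovDeriv G G) x = coordCovDeriv G (fun _ _ => 0) x :=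
      coordCovDeriv_congr hG.isOpen (fun _ _ => rfl)
        (fun y hy => funext fun v => hG.coordCovDeriv_self hy v) hx
    rw [this]
    simp [coordCovDeriv]
  rw [h0, h0] at h
  simp only [Fin.sum_univ_two, update_vec2_zero, update_vec2_one] at h
  simp only [Matrix.cons_val_zero, Matrix.cons_val_one] at h
  simp only [curvTensor_apply]
  rw [hG.symm x hx c] at h
  linarith

/-- The octahedron argument: four cyclic identities are combined by means of the two antisymmetries.
-/
theorem curvTensor_pair_symm (hG : IsMetricOn U G) (hx : x ∈ U) (a b c d : Model n) :
    curvTensor G x ![c, d, a, b] = curvTensor G x ![a, b, c, d] := by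
  have h1 := curvTensor_cyclic hG hx a b c d
  have h2 := curvTensor_cyclic hG hx b c d a
  have h3 := curvTensor_cyclic hG hx c d a b
  have h4 := curvTensor_cyclic hG hx d a b c
  have l := fun a b c d => curvTensor_swap_left hG hx a b c d
  have r := fun a b c d => curvTensor_swap_right hG hx a b c d
  linarith [l a b c d, l b c a d, l c a b d, l b c d a, l c d b a, l d b c a, l c d a b, l d a c b,
    l a c d b, l d a b c, l a b d c, l b d a c, r a b c d, r b c a d, r c a b d, r b c d a,
    r c d b a, r d b c a, r c d a b, r d a c b, r a c d b, r d a b c, r a b d c, r b d a c,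
    r a c b d, r a d b c, r b d c a, l b d c a]

/-! ### The second Bianchi identity -/

/-- Lowering an index commutes with `∇` because the metric is parallel, so the Bianchi identity may
be proved for the operator. -/
theorem coordCovDeriv_curvTensor (hG : IsMetricOn U G) (hx : x ∈ U) (a b w z c : Model n) :
    coordCovDeriv G (curvTensor G) x ![a, b, w, z, c] = G x ![covCurvOp G x a b w c, z] := by
  have e4 : (![a, b, w, z, c] : Fin 5 → Model n) = Fin.snoc ![a, b, w, z] c := by
    ext i : 1; fin_cases i <;> rfl
  have h := hG.tensor.fderiv_update hG.isOpen hx ![0, z] 0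
    (hG.differentiableAt_coordCurvOp hx a b w) c
  simp only [update_vec2_zero] at h
  have h2 := hG.dirDeriv_eq hx c (coordCurvOp G x a b w) z
  rw [e4, coordCovDeriv_snoc]
  simp only [Fin.sum_univ_four, update_vec4_zero, update_vec4_one, update_vec4_two,
    update_vec4_three, curvTensor_apply]
  simp only [Matrix.cons_val_zero, Matrix.cons_val_one, Matrix.cons_val]
  rw [h]
  unfold dirDeriv at h2
  rw [h2]
  unfold covCurvOp
  simp only [← hG.tensor.bilin_apply hx, map_sub, map_add, LinearMap.sub_apply,
    LinearMap.add_apply]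
  ring

/-- The Ricci identity for `1`-tensor fields. -/
theorem ricci_identity_one (hG : IsMetricOn U G) {T : CoordTensor n 1} (hT : IsTensorOn U T)
    (hx : x ∈ U) (w u v : Model n) :
    coordCovDeriv G (coordCovDeriv G T) x ![w, u, v] =
      coordCovDeriv G (coordCovDeriv G T) x ![w, v, u] - T x ![coordCurvOp G x u v w] := by
  have e : ∀ a b c : Model n, (![a, b, c] : Fin 3 → Model n) = Fin.snoc (Fin.snoc ![a] b) c :=
    fun a b c => by ext i : 1; fin_cases i <;> rfl
  have h := ricci_identity hG hT hx ![w] u v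
  rw [Fin.sum_univ_one, update_vec1] at h
  rw [e, e, h]
  rfl

/-- The Ricci identity for `2`-tensor fields. -/
theorem ricci_identity_two (hG : IsMetricOn U G) {T : CoordTensor n 2} (hT : IsTensorOn U T)
    (hx : x ∈ U) (w z u v : Model n) :
    coordCovDeriv G (coordCovDeriv G T) x ![w, z, u, v] =
      coordCovDeriv G (coordCovDeriv G T) x ![w, z, v, u] - T x ![coordCurvOp G x u v w, z] -
        T x ![w, coordCurvOp G x u v z] := by
  have e : ∀ d a b c : Model n, (![d, a, b, c] : Fin 4 → Model n) =
      Fin.snoc (Fin.snoc ![d, a] b) c :=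
    fun d a b c => by ext i : 1; fin_cases i <;> rfl
  have h := ricci_identity hG hT hx ![w, z] u v
  rw [Fin.sum_univ_two, update_vec2_zero, update_vec2_one] at h
  rw [e, e, h, sub_sub]
  rfl

/-- The covariant derivative of the Ricci identity for `1`-tensor fields. -/
theorem coordCovDeriv_ricci_identity (hG : IsMetricOn U G) {T : CoordTensor n 1}
    (hT : IsTensorOn U T) (hx : x ∈ U) (w u v c : Model n) :
    coordCovDeriv G (coordCovDeriv G (coordCovDeriv G T)) x ![w, u, v, c] =
      coordCovDeriv G (coordCovDeriv G (coordCovDeriv G T)) x ![w, v, u, c] -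
        (coordCovDeriv G T x ![coordCurvOp G x u v w, c] + T x ![covCurvOp G x u v w c]) := by
  set S := coordCovDeriv G (coordCovDeriv G T) with hS
  have hST : IsTensorOn U S := (hT.coordCovDeriv hG).coordCovDeriv hG
  set P : CoordTensor n 3 := fun y v => T y ![coordCurvOp G y (v 0) (v 1) (v 2)] with hP
  -- By the Ricci identity `P` is a difference of two permuted copies of `∇∇T`.
  have hPT : IsTensorOn U P := by
    refine (((hST.perm (Equiv.swap 1 2)).sub hST).perm (finRotate 3).symm).congr
      fun y hy => funext fun v => ?_
    have h := ricci_identity_one hG hT hy (v 2) (v 0) (v 1)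
    have h1 : (fun i => v ((finRotate 3).symm i)) = ![v 2, v 0, v 1] := by
      ext i : 1; fin_cases i <;> rfl
    have h2 : (fun i => v ((finRotate 3).symm (Equiv.swap 1 2 i))) = ![v 2, v 1, v 0] := by
      ext i : 1; fin_cases i <;> rfl
    rw [h2, h1]
    simp only [hP, ← hS] at h ⊢
    linarith
  -- The Ricci identity holds on all of `U`, so it can be differentiated.
  have hcongr : coordCovDeriv G S x = coordCovDeriv G (fun y v =>
      S y (fun i => v (Equiv.swap 1 2 i)) - P y fun i => v (finRotate 3 i)) x := by
    refine coordCovDeriv_congr hG.isOpen (fun _ _ => rfl) (fun y hy => funext fun v => ?_) hx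
    have h := ricci_identity_one hG hT hy (v 0) (v 1) (v 2)
    have h1 : v = ![v 0, v 1, v 2] := by
      ext i : 1; fin_cases i <;> rfl
    have h2 : (fun i => v (Equiv.swap 1 2 i)) = ![v 0, v 2, v 1] := by
      ext i : 1; fin_cases i <;> rfl
    rw [h2]
    conv_lhs => rw [h1]
    exact h
  have e : (![w, u, v, c] : Fin 4 → Model n) = Fin.snoc ![w, u, v] c := by
    ext i : 1; fin_cases i <;> rfl
  refine (congrFun hcongr _).trans ?_
  rw [coordCovDeriv_sub hG.isOpen (hST.perm _) (hPT.perm _) hx, e, coordCovDeriv_perm,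
    coordCovDeriv_perm, ← coordCovDeriv_comp_curvOp hG hT hx u v w c]
  congr 2 <;> (ext i : 1; fin_cases i <;> rfl)

/-- Third derivatives of an arbitrary `1`-form are permuted in two ways: the differentiated Ricci
identity exchanges the first two derivatives, the Ricci identity for `∇T` the last two. The cyclic
sums of both differences are the same alternating sum over the six orders. Comparing them, the terms
`∇T(R w, ·)` cancel and the terms `∇T(w, R ·)` vanish by the first Bianchi identity. -/
theorem covCurvOp_cyclic (hG : IsMetricOn U G) (hx : x ∈ U) (a b c w : Model n) :
    covCurvOp G x a b w c + covCurvOp G x b c w a + covCurvOp G x c a w b = 0 := by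
  refine ext_inner_right ℝ fun z => ?_
  set T : CoordTensor n 1 := fun _ v => inner ℝ (v 0) z with hTd
  have hT : IsTensorOn U T := by
    refine IsTensorOn.of_update (fun x _ v i c a b => ?_) ?_
    · rw [Subsingleton.elim i 0]
      simp [hTd, inner_add_left, inner_smul_left]
    · exact (ContDiff.inner ℝ (by fun_prop) contDiff_const).contDiffOn
  have hT1 := hT.coordCovDeriv hG
  have h1 := coordCovDeriv_ricci_identity hG hT hx w a b c
  have h2 := coordCovDeriv_ricci_identity hG hT hx w b c a
  have h3 := coordCovDeriv_ricci_identity hG hT hx w c a b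
  have h4 := ricci_identity_two hG hT1 hx w a b c
  have h5 := ricci_identity_two hG hT1 hx w b c a
  have h6 := ricci_identity_two hG hT1 hx w c a b
  have h7 : coordCovDeriv G T x ![w, coordCurvOp G x a b c] +
      coordCovDeriv G T x ![w, coordCurvOp G x b c a] +
      coordCovDeriv G T x ![w, coordCurvOp G x c a b] = 0 := by
    simp only [← hT1.bilin_apply hx, ← map_add, hG.coordCurvOp_cyclic hx, map_zero]
  have h8 : T x ![covCurvOp G x a b w c] + T x ![covCurvOp G x b c w a] +
      T x ![covCurvOp G x c a w b] = 0 := by linarith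
  simpa [hTd, inner_add_left] using h8

theorem coordCovDeriv_curvTensor_bianchi (hG : IsMetricOn U G) (hx : x ∈ U) (a b c w z : Model n) :
    coordCovDeriv G (curvTensor G) x ![a, b, w, z, c] +
      coordCovDeriv G (curvTensor G) x ![b, c, w, z, a] +
      coordCovDeriv G (curvTensor G) x ![c, a, w, z, b] = 0 := by
  simp only [coordCovDeriv_curvTensor hG hx, ← hG.tensor.bilin_apply hx, ← LinearMap.add_apply,
    ← map_add, covCurvOp_cyclic hG hx, map_zero, LinearMap.zero_apply]

end

/-! ### The commutator computation in components -/

section Components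

variable {ι : Type*} [Fintype ι] [DecidableEq ι] {κ : ℝ} {f : ι → ℝ}
  {R DDRic DDH DDΦ : ι → ι → ι → ι → ℝ} {DR : ι → ι → ι → ι → ι → ℝ}
  {DDR : ι → ι → ι → ι → ι → ι → ℝ} {Ric H Φ : ι → ι → ℝ} {DRic : ι → ι → ι → ℝ}

/-- The components in an orthonormal frame of the curvature tensor `R`, of the Ricci tensor, of the
Hessian `H` of a function with differential `f`, of the tensor `Φ = κ g - Ric - H` and of their
covariant derivatives, with the relations between them. -/
structure SolitonComponents (κ : ℝ) (f : ι → ℝ) (R : ι → ι → ι → ι → ℝ)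
    (DR : ι → ι → ι → ι → ι → ℝ) (DDR : ι → ι → ι → ι → ι → ι → ℝ) (Ric : ι → ι → ℝ)
    (DRic : ι → ι → ι → ℝ) (DDRic : ι → ι → ι → ι → ℝ) (H : ι → ι → ℝ)
    (DDH : ι → ι → ι → ι → ℝ) (Φ : ι → ι → ℝ) (DDΦ : ι → ι → ι → ι → ℝ) : Prop where
  R_left : ∀ a b c d, R b a c d = -R a b c d
  R_right : ∀ a b c d, R a b d c = -R a b c d
  R_pair : ∀ a b c d, R c d a b = R a b c d
  DR_left : ∀ a b c d m, DR b a c d m = -DR a b c d m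
  DR_right : ∀ a b c d m, DR a b d c m = -DR a b c d m
  DR_pair : ∀ a b c d m, DR c d a b m = DR a b c d m
  DR_bianchi : ∀ a b c w z, DR a b w z c + DR b c w z a + DR c a w z b = 0
  DDR_left : ∀ a b c d l m, DDR b a c d l m = -DDR a b c d l m
  DDR_right : ∀ a b c d l m, DDR a b d c l m = -DDR a b c d l m
  DDR_bianchi : ∀ a b c w z m, DDR a b w z c m + DDR b c w z a m + DDR c a w z b m = 0
  Ric_eq : ∀ i j, Ric i j = ∑ k, R k i k j
  DRic_eq : ∀ i j m, DRic i j m = ∑ k, DR k i k j m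
  DDRic_eq : ∀ i j l m, DDRic i j l m = ∑ k, DDR k i k j l m
  H_symm : ∀ i j, H i j = H j i
  DDH_symm : ∀ i j k l, DDH i j k l = DDH j i k l
  DDH_ricci : ∀ w u v c, DDH w u v c = DDH w v u c -
    (∑ m, R u v w m * H m c + ∑ m, DR u v w m c * f m)
  DDH_ricci_two : ∀ w z u v, DDH w z u v = DDH w z v u - ∑ m, R u v w m * H m z -
    ∑ m, R u v z m * H w m
  DDH_trace : ∀ i j, ∑ k, DDH k k i j = ∑ k, DDH k k j i
  Φ_eq : ∀ i j, Φ i j = κ * (if i = j then 1 else 0) - Ric i j - H i j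
  DDΦ_eq : ∀ i j k l, DDΦ i j k l = -DDRic i j k l - DDH i j k l
  DDΦ_trace : ∀ i j, ∑ k, DDΦ k k i j = ∑ k, DDΦ k k j i

namespace SolitonComponents

variable (h : SolitonComponents κ f R DR DDR Ric DRic DDRic H DDH Φ DDΦ)
include h

theorem Ric_symm (i j : ι) : Ric i j = Ric j i := by
  rw [h.Ric_eq, h.Ric_eq]
  exact Finset.sum_congr rfl fun k _ => h.R_pair _ _ _ _

/-- The twice contracted second Bianchi identity, differentiated once. -/
theorem sum_DDRic (i j : ι) : ∑ k, DDRic k k i j = 2 * ∑ k, DDRic i k k j := by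
  have h1 : ∑ k, DDRic k k i j + ∑ m, -DDRic i m m j + ∑ k, -DDRic i k k j = 0 := by
    simp only [h.DDRic_eq, ← Finset.sum_neg_distrib]
    conv_lhs => enter [1, 2]; rw [Finset.sum_comm]
    rw [← Finset.sum_add_distrib, ← Finset.sum_add_distrib]
    refine Finset.sum_eq_zero fun k _ => ?_
    rw [← Finset.sum_add_distrib, ← Finset.sum_add_distrib]
    refine Finset.sum_eq_zero fun m _ => ?_
    have := h.DDR_bianchi m k i m k j
    rw [h.DDR_right k i k m m j, h.DDR_left m i m k k j] at this
    exact this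
  rw [Finset.sum_neg_distrib] at h1
  linarith

/-- Symmetry of the Hessian brings the contracted index to the front; one commutation then puts its
partner next to it. -/
theorem sum_DDH_trace (i j : ι) : ∑ k, DDH i k k j = ∑ k, DDH k k i j -
    ∑ k, (∑ m, R i k k m * H m j + ∑ m, DR i k k m j * f m) := by
  rw [← Finset.sum_sub_distrib]
  exact Finset.sum_congr rfl fun k _ => by rw [h.DDH_symm i k, h.DDH_ricci k i k j]

/-- In `φ_{kk,ij} - 2 φ_{ik,kj}` the second derivatives of `Ric` cancel by `sum_DDRic`; what remains
is `2 f_{ik,kj} - f_{kk,ij}`. -/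
theorem trace_DDH (i j : ι) : ∑ k, DDH k k i j =
    2 * ∑ k, (∑ m, R i k k m * H m j + ∑ m, DR i k k m j * f m) + ∑ k, DDΦ k k i j -
      2 * ∑ k, DDΦ i k k j := by
  have h1 := h.sum_DDRic i j
  have h2 := h.sum_DDH_trace i j
  simp only [h.DDΦ_eq, Finset.sum_sub_distrib, Finset.sum_neg_distrib]
  linarith

/-- A once contracted second Bianchi identity: the derivatives of curvature left over from the
commutations combine to `∇_{∇f} Ric`, the term that the drift absorbs. -/
theorem sum_DR (i j : ι) : ∑ k, ∑ m, DR j k k m i * f m - ∑ k, ∑ m, DR j k i m k * f m =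
    -∑ m, DRic i j m * f m := by
  rw [← Finset.sum_sub_distrib]
  simp only [← Finset.sum_sub_distrib, h.DRic_eq, Finset.sum_mul]
  rw [Finset.sum_comm, ← Finset.sum_neg_distrib]
  refine Finset.sum_congr rfl fun m _ => ?_
  rw [← Finset.sum_neg_distrib]
  refine Finset.sum_congr rfl fun k _ => ?_
  have h1 := h.DR_bianchi k m i j k
  rw [h.DR_pair j k k m, h.DR_pair j k m i, h.DR_right j k i m, h.DR_pair j k i k,
    h.DR_left k j i k, h.DR_right k j k i, h.DR_pair k i k j] at h1
  linear_combination f m * h1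

/-- The core commutation: `f_{ij,kk}` becomes `f_{ik,jk}`, then `f_{ik,kj}`, then a trace that is
expressed through `φ`. -/
theorem sum_DDH (i j : ι) : ∑ k, DDH i j k k =
    -2 * ∑ k, ∑ m, R j k i m * H m k - ∑ m, DRic i j m * f m + ∑ k, DDΦ k k j i -
      ∑ k, DDΦ i k k j - ∑ k, DDΦ j k k i := by
  have h1 : ∑ k, DDH i j k k = ∑ k, DDH i k k j - 2 * ∑ k, ∑ m, R j k i m * H m k -
      ∑ k, ∑ m, R j k k m * H m i - ∑ k, ∑ m, DR j k i m k * f m := by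
    rw [Finset.mul_sum, ← Finset.sum_sub_distrib, ← Finset.sum_sub_distrib,
      ← Finset.sum_sub_distrib]
    refine Finset.sum_congr rfl fun k _ => ?_
    rw [h.DDH_ricci i j k k, h.DDH_ricci_two i k j k]
    simp only [h.H_symm i]
    ring
  have h2 := h.sum_DDH_trace i j
  have h3 := h.trace_DDH i j
  have h4 := h.trace_DDH j i
  -- Half of the trace is replaced by `h3`, the other half by `h4` with `i` and `j` exchanged. The
  -- first half removes the curvature terms of `h2`; the second cancels `R j k k m * H m i` and
  -- leaves the combination in `h7`.
  have h5 := h.DDH_trace i j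
  have h6 := h.DDΦ_trace i j
  have h7 := h.sum_DR i j
  simp only [Finset.sum_add_distrib] at h2 h3 h4
  linarith

/-- In `sum_DDH` the derivative of `Ric` along the gradient cancels the drift, and `R * H` is
eliminated by splitting `R * Φ` according to the definition of `Φ`. -/
theorem ricci_evolution (i j : ι) :
    ∑ k, DDRic i j k k - ∑ m, DRic i j m * f m + 2 * ∑ l, ∑ k, R l i k j * Ric l k =
      2 * κ * Ric i j + 2 * ∑ k, ∑ m, R k j i m * Φ m k - ∑ k, DDΦ i j k k - ∑ k, DDΦ k k j i +
        ∑ k, DDΦ j k k i + ∑ k, DDΦ i k k j := by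
  have h1 := h.sum_DDH i j
  have h2 : ∑ k, ∑ m, R k j i m * Φ m k = -κ * Ric i j + ∑ l, ∑ k, R l i k j * Ric l k +
      ∑ k, ∑ m, R j k i m * H m k := by
    have e1 : ∑ k, ∑ m, R k j i m * (κ * (if m = k then 1 else 0)) = -κ * Ric i j := by
      simp only [mul_ite, mul_one, mul_zero, Finset.sum_ite_eq', Finset.mem_univ, if_true]
      rw [h.Ric_symm, h.Ric_eq, Finset.mul_sum]
      exact Finset.sum_congr rfl fun k _ => by rw [h.R_right k j k i]; ring
    have e2 : ∑ l, ∑ k, R l i k j * Ric l k = -∑ k, ∑ m, R k j i m * Ric m k := by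
      rw [Finset.sum_comm, ← Finset.sum_neg_distrib]
      refine Finset.sum_congr rfl fun k _ => ?_
      rw [← Finset.sum_neg_distrib]
      refine Finset.sum_congr rfl fun l _ => ?_
      rw [h.R_pair k j l i, h.R_right k j i l]; ring
    have e3 : ∑ k, ∑ m, R j k i m * H m k = -∑ k, ∑ m, R k j i m * H m k := by
      simp only [h.R_left _ j, neg_mul, Finset.sum_neg_distrib]
    rw [e2, e3, ← e1]
    simp only [h.Φ_eq, mul_sub, Finset.sum_sub_distrib]
    ring
  have h3 : ∑ k, DDΦ i j k k = -∑ k, DDRic i j k k - ∑ k, DDH i j k k := by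
    simp only [h.DDΦ_eq, Finset.sum_sub_distrib, Finset.sum_neg_distrib]
  linarith

/-- The trace of `ricci_evolution`: `R * Ric` becomes `|Ric|²`, and the two trace terms and the two
divergence terms in `Φ` each merge into one with factor `2`. -/
theorem scalar_evolution :
    ∑ k, ∑ i, DDRic i i k k - ∑ m, (∑ i, DRic i i m) * f m =
      2 * κ * ∑ k, Ric k k - 2 * ∑ k, ∑ m, Ric k m ^ 2 - 2 * ∑ k, ∑ m, Ric k m * Φ m k -
        2 * ∑ k, ∑ i, DDΦ i i k k + 2 * ∑ i, ∑ k, DDΦ i k k i := by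
  have h1 := Finset.sum_congr (s₁ := Finset.univ) rfl fun i _ => h.ricci_evolution i i
  simp only [Finset.sum_add_distrib, Finset.sum_sub_distrib, ← Finset.mul_sum] at h1
  have e1 : ∑ i, ∑ l, ∑ k, R l i k i * Ric l k = ∑ k, ∑ m, Ric k m ^ 2 := by
    rw [Finset.sum_comm]
    refine Finset.sum_congr rfl fun l _ => ?_
    rw [Finset.sum_comm]
    refine Finset.sum_congr rfl fun k _ => ?_
    rw [sq, ← Finset.sum_mul]
    congr 1
    rw [h.Ric_eq l k]
    exact Finset.sum_congr rfl fun i _ => by rw [h.R_left i l, h.R_right i l i k]; ring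
  have e2 : ∑ i, ∑ k, ∑ m, R k i i m * Φ m k = -∑ k, ∑ m, Ric k m * Φ m k := by
    rw [Finset.sum_comm, ← Finset.sum_neg_distrib]
    refine Finset.sum_congr rfl fun k _ => ?_
    rw [Finset.sum_comm, ← Finset.sum_neg_distrib]
    refine Finset.sum_congr rfl fun m _ => ?_
    rw [← Finset.sum_mul, h.Ric_eq k m, ← neg_mul, ← Finset.sum_neg_distrib]
    congr 1
    exact Finset.sum_congr rfl fun i _ => h.R_left i k i m
  have e3 : ∑ i, ∑ m, DRic i i m * f m = ∑ m, (∑ i, DRic i i m) * f m := by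
    rw [Finset.sum_comm]
    simp only [Finset.sum_mul]
  have e4 : ∑ k, ∑ i, DDRic i i k k = ∑ i, ∑ k, DDRic i i k k := Finset.sum_comm
  have e5 : ∑ k, ∑ i, DDΦ i i k k = ∑ i, ∑ k, DDΦ i i k k := Finset.sum_comm
  rw [e1, e2, e3] at h1
  rw [e4]
  linarith

end SolitonComponents

end Components

/-! ### The Ricci tensor and the soliton defect on open sets -/

theorem vec4_eta {E : Type*} (v : Fin 4 → E) : v = ![v 0, v 1, v 2, v 3] := by
  ext i : 1; fin_cases i <;> rfl

theorem vec5_eta {E : Type*} (v : Fin 5 → E) : v = ![v 0, v 1, v 2, v 3, v 4] := by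
  ext i : 1; fin_cases i <;> rfl

section

variable {n k : ℕ} {U : Set (Model n)} {G : CoordTensor n 2} {x : Model n}
  {e : Fin n → Model n}

/-- Second covariant derivatives commute with contractions. -/
theorem coordCovDeriv_coordCovDeriv_contr (hG : IsMetricOn U G) {T : CoordTensor n (k + 2)}
    (hT : IsTensorOn U T) (hx : x ∈ U) (w : Fin k → Model n) (u v : Model n) :
    coordCovDeriv G (coordCovDeriv G (contr G T)) x (Fin.snoc (Fin.snoc w u) v) =
      contr G (k := k + 2) (coordCovDeriv G (coordCovDeriv G T)) x
        (Fin.snoc (Fin.snoc w u) v) := by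
  rw [coordCovDeriv_congr (T' := contr G (k := k + 1) (coordCovDeriv G T)) hG.isOpen
    (fun _ _ => rfl) (fun y hy => funext fun v => ?_) hx]
  · exact coordCovDeriv_contr hG (hT.coordCovDeriv hG) hx _ _
  · rw [← Fin.snoc_init_self v]
    exact coordCovDeriv_contr hG hT hy _ _

/-- The Ricci tensor on an open set. -/
noncomputable def ricciTensor (G : CoordTensor n 2) : CoordTensor n 2 :=
  -- The exchange puts slots `0` and `2` of the curvature in the places that `contr` contracts.
  contr G (k := 2) fun y v => curvTensor G y fun i => v (Equiv.swap 1 2 i)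

theorem IsMetricOn.ricciTensor (hG : IsMetricOn U G) : IsTensorOn U (ricciTensor G) :=
  (hG.curvTensor.perm _).contr hG

theorem ricciTensor_eq_sum
    (he : ∀ i j, G x ![e i, e j] = if i = j then 1 else 0)
    (hG : IsMetricOn U G) (hx : x ∈ U) (a b : Model n) :
    ricciTensor G x ![a, b] = ∑ k, curvTensor G x ![e k, a, e k, b] := by
  rw [ricciTensor, contr_eq_sum_orthonormal hG (hG.curvTensor.perm _) hx he]
  refine Finset.sum_congr rfl fun k _ => congrArg _ ?_
  ext i : 1; fin_cases i <;> rfl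

/-- The frame exists at `x` only and is never differentiated: the contraction is moved past `∇`
first and evaluated in the frame afterwards. -/
theorem coordCovDeriv_ricciTensor_eq_sum
    (he : ∀ i j, G x ![e i, e j] = if i = j then 1 else 0)
    (hG : IsMetricOn U G) (hx : x ∈ U) (a b c : Model n) :
    coordCovDeriv G (ricciTensor G) x ![a, b, c] =
      ∑ k, coordCovDeriv G (curvTensor G) x ![e k, a, e k, b, c] := by
  have e2 : (![a, b, c] : Fin 3 → Model n) = Fin.snoc ![a, b] c := by
    ext i : 1; fin_cases i <;> rfl
  have hP := hG.curvTensor.perm (Equiv.swap 1 2)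
  rw [e2, ricciTensor, coordCovDeriv_contr hG hP hx,
    contr_eq_sum_orthonormal hG (hP.coordCovDeriv hG) hx he]
  refine Finset.sum_congr rfl fun k _ => ?_
  rw [Fin.cons_snoc_eq_snoc_cons, Fin.cons_snoc_eq_snoc_cons, coordCovDeriv_perm]
  congr 1
  ext i : 1; fin_cases i <;> rfl

theorem coordCovDeriv_coordCovDeriv_ricciTensor_eq_sum
    (he : ∀ i j, G x ![e i, e j] = if i = j then 1 else 0)
    (hG : IsMetricOn U G) (hx : x ∈ U)
    (a b c d : Model n) :
    coordCovDeriv G (coordCovDeriv G (ricciTensor G)) x ![a, b, c, d] =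
      ∑ k, coordCovDeriv G (coordCovDeriv G (curvTensor G)) x ![e k, a, e k, b, c, d] := by
  have e2 : (![a, b, c, d] : Fin 4 → Model n) = Fin.snoc (Fin.snoc ![a, b] c) d := by
    ext i : 1; fin_cases i <;> rfl
  have hP := hG.curvTensor.perm (Equiv.swap 1 2)
  rw [e2, ricciTensor, coordCovDeriv_coordCovDeriv_contr hG hP hx,
    contr_eq_sum_orthonormal hG ((hP.coordCovDeriv hG).coordCovDeriv hG) hx he]
  have hQ := hG.curvTensor.coordCovDeriv hG
  have hc : coordCovDeriv G (coordCovDeriv G fun y v => curvTensor G y fun i =>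
      v (Equiv.swap 1 2 i)) x = coordCovDeriv G (fun y v => coordCovDeriv G (curvTensor G) y
        fun i => v (Equiv.swap 1 2 i)) x := by
    refine coordCovDeriv_congr hG.isOpen (fun _ _ => rfl) (fun y hy => funext fun v => ?_) hx
    conv_lhs => rw [← Fin.snoc_init_self v]
    rw [coordCovDeriv_perm]
    congr 1
    ext i : 1; fin_cases i <;> rfl
  refine Finset.sum_congr rfl fun k _ => ?_
  rw [Fin.cons_snoc_eq_snoc_cons, Fin.cons_snoc_eq_snoc_cons, hc, coordCovDeriv_perm]
  congr 1
  ext i : 1; fin_cases i <;> rfl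

/-- Exhibits the traced second derivative as a Hessian, hence symmetric in `a` and `b`. -/
theorem sum_coordCovDeriv_coordCovDeriv_eq
    (he : ∀ i j, G x ![e i, e j] = if i = j then 1 else 0)
    (hG : IsMetricOn U G) {T : CoordTensor n 2}
    (hT : IsTensorOn U T) (hx : x ∈ U) (a b : Model n) :
    ∑ k, coordCovDeriv G (coordCovDeriv G T) x ![e k, e k, a, b] =
      coordCovDeriv G (coordCovDeriv G (contr G (k := 0) T)) x ![a, b] := by
  have e2 : (![a, b] : Fin 2 → Model n) = Fin.snoc (Fin.snoc ![] a) b := by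
    ext i : 1; fin_cases i <;> rfl
  rw [e2, coordCovDeriv_coordCovDeriv_contr hG hT hx,
    contr_eq_sum_orthonormal hG ((hT.coordCovDeriv hG).coordCovDeriv hG) hx he]
  refine Finset.sum_congr rfl fun k _ => ?_
  congr 1

/-- A function has no slots, so the curvature sum in the Ricci identity is empty. -/
theorem hessian_symm (hG : IsMetricOn U G) {F : CoordTensor n 0} (hF : IsTensorOn U F)
    (hx : x ∈ U) (a b : Model n) : coordCovDeriv G (coordCovDeriv G F) x ![a, b] =
      coordCovDeriv G (coordCovDeriv G F) x ![b, a] := by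
  have e2 : ∀ a b : Model n, (![a, b] : Fin 2 → Model n) = Fin.snoc (Fin.snoc ![] a) b :=
    fun a b => by ext i : 1; fin_cases i <;> rfl
  have := ricci_identity hG hF hx ![] a b
  rw [e2, e2, this]
  simp

theorem coordCovDeriv_curvTensor_swap_left (hG : IsMetricOn U G) (hx : x ∈ U)
    (a b c d m : Model n) : coordCovDeriv G (curvTensor G) x ![b, a, c, d, m] =
      -coordCovDeriv G (curvTensor G) x ![a, b, c, d, m] := by
  rw [coordCovDeriv_symmetry hG hG.curvTensor (Equiv.swap 0 1) (-1) (fun y hy v => ?_) hx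
    (w := ![a, b, c, d, m]) (by ext i : 1; fin_cases i <;> rfl), neg_one_mul]
  rw [neg_one_mul, vec4_eta v, ← curvTensor_swap_left hG hy (v 0) (v 1) (v 2) (v 3)]
  congr 1
  ext i : 1; fin_cases i <;> rfl

theorem coordCovDeriv_curvTensor_swap_right (hG : IsMetricOn U G) (hx : x ∈ U)
    (a b c d m : Model n) : coordCovDeriv G (curvTensor G) x ![a, b, d, c, m] =
      -coordCovDeriv G (curvTensor G) x ![a, b, c, d, m] := by
  rw [coordCovDeriv_symmetry hG hG.curvTensor (Equiv.swap 2 3) (-1) (fun y hy v => ?_) hx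
    (w := ![a, b, c, d, m]) (by ext i : 1; fin_cases i <;> rfl), neg_one_mul]
  rw [neg_one_mul, vec4_eta v, ← curvTensor_swap_right hG hy (v 0) (v 1) (v 2) (v 3)]
  congr 1
  ext i : 1; fin_cases i <;> rfl

theorem coordCovDeriv_curvTensor_pair_symm (hG : IsMetricOn U G) (hx : x ∈ U)
    (a b c d m : Model n) : coordCovDeriv G (curvTensor G) x ![c, d, a, b, m] =
      coordCovDeriv G (curvTensor G) x ![a, b, c, d, m] := by
  rw [coordCovDeriv_symmetry hG hG.curvTensor (Equiv.swap 0 2 * Equiv.swap 1 3) 1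
    (fun y hy v => ?_) hx
    (w := ![a, b, c, d, m]) (by ext i : 1; fin_cases i <;> rfl), one_mul]
  rw [one_mul, vec4_eta v, ← curvTensor_pair_symm hG hy (v 0) (v 1) (v 2) (v 3)]
  congr 1
  ext i : 1; fin_cases i <;> rfl

theorem coordCovDeriv_coordCovDeriv_curvTensor_swap_left (hG : IsMetricOn U G) (hx : x ∈ U)
    (a b c d l m : Model n) :
    coordCovDeriv G (coordCovDeriv G (curvTensor G)) x ![b, a, c, d, l, m] =
      -coordCovDeriv G (coordCovDeriv G (curvTensor G)) x ![a, b, c, d, l, m] := by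
  rw [coordCovDeriv_symmetry hG (hG.curvTensor.coordCovDeriv hG) (Equiv.swap 0 1) (-1)
    (fun y hy v => ?_) hx (w := ![a, b, c, d, l, m]) (by ext i : 1; fin_cases i <;> rfl),
    neg_one_mul]
  rw [neg_one_mul, vec5_eta v,
    ← coordCovDeriv_curvTensor_swap_left hG hy (v 0) (v 1) (v 2) (v 3) (v 4)]
  congr 1
  ext i : 1; fin_cases i <;> rfl

theorem coordCovDeriv_coordCovDeriv_curvTensor_swap_right (hG : IsMetricOn U G) (hx : x ∈ U)
    (a b c d l m : Model n) :
    coordCovDeriv G (coordCovDeriv G (curvTensor G)) x ![a, b, d, c, l, m] =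
      -coordCovDeriv G (coordCovDeriv G (curvTensor G)) x ![a, b, c, d, l, m] := by
  rw [coordCovDeriv_symmetry hG (hG.curvTensor.coordCovDeriv hG) (Equiv.swap 2 3) (-1)
    (fun y hy v => ?_) hx (w := ![a, b, c, d, l, m]) (by ext i : 1; fin_cases i <;> rfl),
    neg_one_mul]
  rw [neg_one_mul, vec5_eta v,
    ← coordCovDeriv_curvTensor_swap_right hG hy (v 0) (v 1) (v 2) (v 3) (v 4)]
  congr 1
  ext i : 1; fin_cases i <;> rfl

theorem coordCovDeriv_coordCovDeriv_curvTensor_bianchi (hG : IsMetricOn U G) (hx : x ∈ U)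
    (a b c w z m : Model n) :
    coordCovDeriv G (coordCovDeriv G (curvTensor G)) x ![a, b, w, z, c, m] +
      coordCovDeriv G (coordCovDeriv G (curvTensor G)) x ![b, c, w, z, a, m] +
      coordCovDeriv G (coordCovDeriv G (curvTensor G)) x ![c, a, w, z, b, m] = 0 := by
  -- The Bianchi identity permutes slots `0`, `1` and `4` of `∇R`; the two permutations are the
  -- three-cycles on them.
  refine coordCovDeriv_cyclic hG (hG.curvTensor.coordCovDeriv hG)
    (Equiv.swap 0 1 * Equiv.swap 1 4) (Equiv.swap 1 4 * Equiv.swap 0 1) (fun y hy v => ?_) hx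
    (by ext i : 1; fin_cases i <;> rfl) (by ext i : 1; fin_cases i <;> rfl)
  rw [← coordCovDeriv_curvTensor_bianchi hG hy (v 0) (v 1) (v 4) (v 2) (v 3)]
  refine congr_arg₂ _ (congr_arg₂ _ (congrArg _ (vec5_eta v)) (congrArg _ ?_)) (congrArg _ ?_)
  · ext i : 1; fin_cases i <;> rfl
  · ext i : 1; fin_cases i <;> rfl

theorem coordCovDeriv_symmetric_two (hG : IsMetricOn U G) {T : CoordTensor n 2}
    (hT : IsTensorOn U T) (h : ∀ y ∈ U, ∀ a b, T y ![a, b] = T y ![b, a]) (hx : x ∈ U)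
    (a b c d : Model n) : coordCovDeriv G (coordCovDeriv G T) x ![a, b, c, d] =
      coordCovDeriv G (coordCovDeriv G T) x ![b, a, c, d] := by
  rw [coordCovDeriv_symmetry hG (hT.coordCovDeriv hG) (Equiv.swap 0 1) 1
    (fun y hy v => ?_) hx (w := ![b, a, c, d]) (by ext i : 1; fin_cases i <;> rfl), one_mul]
  refine coordCovDeriv_symmetry hG hT (Equiv.swap 0 1) 1 (fun z hz w => ?_) hy
    (by ext i : 1; fin_cases i <;> rfl)
  have e2 : w = ![w 0, w 1] := by ext i : 1; fin_cases i <;> rfl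
  rw [one_mul]
  conv_rhs => rw [e2, h z hz]
  congr 1
  ext i : 1; fin_cases i <;> rfl

theorem IsMetricOn.sum_inner_smul
    (he : ∀ i j, G x ![e i, e j] = if i = j then 1 else 0)
    (hG : IsMetricOn U G) (hx : x ∈ U) (w : Model n) :
    ∑ m, G x ![w, e m] • e m = w := by
  have := sum_orthonormal (B := hG.tensor.bilin hx) he w
  simp only [IsTensorOn.bilin_apply] at this
  conv_rhs => rw [← this]
  exact Finset.sum_congr rfl fun m _ => by rw [hG.symm x hx]

/-- The passage from geometry to finite sums: from here on only the index relations at one point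
matter. -/
theorem solitonComponents
    (he : ∀ i j, G x ![e i, e j] = if i = j then 1 else 0)
    (hG : IsMetricOn U G) {F : CoordTensor n 0} (hF : IsTensorOn U F)
    {κ : ℝ} {φ : CoordTensor n 2} (hφ : ∀ y ∈ U, ∀ v, φ y v =
      κ * G y v - ricciTensor G y v - coordCovDeriv G (coordCovDeriv G F) y v) (hx : x ∈ U) :
    SolitonComponents κ (fun m => coordCovDeriv G F x ![e m])
      (fun a b c d => curvTensor G x ![e a, e b, e c, e d])
      (fun a b c d m => coordCovDeriv G (curvTensor G) x ![e a, e b, e c, e d, e m])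
      (fun a b c d l m => coordCovDeriv G (coordCovDeriv G (curvTensor G)) x
        ![e a, e b, e c, e d, e l, e m])
      (fun a b => ricciTensor G x ![e a, e b])
      (fun a b m => coordCovDeriv G (ricciTensor G) x ![e a, e b, e m])
      (fun a b l m => coordCovDeriv G (coordCovDeriv G (ricciTensor G)) x ![e a, e b, e l, e m])
      (fun a b => coordCovDeriv G (coordCovDeriv G F) x ![e a, e b])
      (fun a b l m => coordCovDeriv G (coordCovDeriv G (coordCovDeriv G (coordCovDeriv G F))) x
        ![e a, e b, e l, e m])
      (fun a b => φ x ![e a, e b])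
      (fun a b l m => coordCovDeriv G (coordCovDeriv G φ) x ![e a, e b, e l, e m]) := by
  have hR := hG.curvTensor
  have hDR := hR.coordCovDeriv hG
  have hRic := hG.ricciTensor
  have hdF := hF.coordCovDeriv hG
  have hH := hdF.coordCovDeriv hG
  have hDH := hH.coordCovDeriv hG
  have hDRic := hRic.coordCovDeriv hG
  have hφT : IsTensorOn U φ :=
    (((hG.tensor.const_smul κ).sub hRic).sub hH).congr fun y hy => funext fun v => hφ y hy v
  have hHx : ∀ y ∈ U, ∀ a b, coordCovDeriv G (coordCovDeriv G F) y ![a, b] =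
      coordCovDeriv G (coordCovDeriv G F) y ![b, a] := fun y hy a b => hessian_symm hG hF hy a b
  -- Expanding curvature operators in the frame turns the Ricci identities into index form.
  have frameR : ∀ a b c, coordCurvOp G x a b c = ∑ m, curvTensor G x ![a, b, c, e m] • e m :=
    fun a b c => (IsMetricOn.sum_inner_smul he hG hx _).symm
  have frameDR : ∀ a b w c, covCurvOp G x a b w c =
      ∑ m, coordCovDeriv G (curvTensor G) x ![a, b, w, e m, c] • e m := fun a b w c => by
    simp only [coordCovDeriv_curvTensor hG hx]
    exact (IsMetricOn.sum_inner_smul he hG hx _).symm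
  have hDDφ : ∀ v, coordCovDeriv G (coordCovDeriv G φ) x v =
      -coordCovDeriv G (coordCovDeriv G (ricciTensor G)) x v -
        coordCovDeriv G (coordCovDeriv G (coordCovDeriv G (coordCovDeriv G F))) x v := by
    intro v
    have h1 : ∀ y ∈ U, coordCovDeriv G φ y = fun v => (-1 : ℝ) •
        coordCovDeriv G (ricciTensor G) y v -
          coordCovDeriv G (coordCovDeriv G (coordCovDeriv G F)) y v := fun y hy => by
      funext v
      have h0 : coordCovDeriv G (fun z v => κ * G z v) y v = κ * coordCovDeriv G G y v :=
        coordCovDeriv_const_smul hG.isOpen hG.tensor κ hy v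
      rw [coordCovDeriv_congr (G' := G) hG.isOpen (fun _ _ => rfl)
        (fun z hz => funext fun v => hφ z hz v) hy,
        coordCovDeriv_sub hG.isOpen (T := fun z v => κ * G z v - ricciTensor G z v)
          ((hG.tensor.const_smul κ).sub hRic) hH hy,
        coordCovDeriv_sub hG.isOpen (T := fun z v => κ * G z v) (hG.tensor.const_smul κ) hRic hy,
        h0, hG.coordCovDeriv_self hy]
      simp
    rw [coordCovDeriv_congr (G' := G) hG.isOpen (fun _ _ => rfl) h1 hx,
      coordCovDeriv_sub hG.isOpen (hDRic.const_smul _) hDH hx,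
      coordCovDeriv_const_smul hG.isOpen hDRic _ hx]
    ring
  have trace_symm : ∀ {T : CoordTensor n 2}, IsTensorOn U T → ∀ a b,
      ∑ k, coordCovDeriv G (coordCovDeriv G T) x ![e k, e k, a, b] =
        ∑ k, coordCovDeriv G (coordCovDeriv G T) x ![e k, e k, b, a] := fun {T} hT a b => by
    rw [sum_coordCovDeriv_coordCovDeriv_eq he hG hT hx,
      sum_coordCovDeriv_coordCovDeriv_eq he hG hT hx]
    exact hessian_symm hG (hT.contr (k := 0) hG) hx a b
  exact
  { R_left := fun a b c d => curvTensor_swap_left hG hx _ _ _ _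
    R_right := fun a b c d => curvTensor_swap_right hG hx _ _ _ _
    R_pair := fun a b c d => curvTensor_pair_symm hG hx _ _ _ _
    DR_left := fun a b c d m => coordCovDeriv_curvTensor_swap_left hG hx _ _ _ _ _
    DR_right := fun a b c d m => coordCovDeriv_curvTensor_swap_right hG hx _ _ _ _ _
    DR_pair := fun a b c d m => coordCovDeriv_curvTensor_pair_symm hG hx _ _ _ _ _
    DR_bianchi := fun a b c w z => coordCovDeriv_curvTensor_bianchi hG hx _ _ _ _ _
    DDR_left := fun a b c d l m =>
      coordCovDeriv_coordCovDeriv_curvTensor_swap_left hG hx _ _ _ _ _ _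
    DDR_right := fun a b c d l m =>
      coordCovDeriv_coordCovDeriv_curvTensor_swap_right hG hx _ _ _ _ _ _
    DDR_bianchi := fun a b c w z m =>
      coordCovDeriv_coordCovDeriv_curvTensor_bianchi hG hx _ _ _ _ _ _
    Ric_eq := fun i j => ricciTensor_eq_sum he hG hx _ _
    DRic_eq := fun i j m => coordCovDeriv_ricciTensor_eq_sum he hG hx _ _ _
    DDRic_eq := fun i j l m => coordCovDeriv_coordCovDeriv_ricciTensor_eq_sum he hG hx _ _ _ _
    H_symm := fun i j => hHx x hx _ _
    DDH_symm := fun i j k l => coordCovDeriv_symmetric_two hG hH hHx hx _ _ _ _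
    DDH_ricci := fun w u v c => by
      have h := coordCovDeriv_ricci_identity hG hdF hx (e w) (e u) (e v) (e c)
      rw [frameR, frameDR, ← hH.bilin_apply hx, ← hdF.lin_apply hx] at h
      simpa [LinearMap.sum_apply] using h
    DDH_ricci_two := fun w z u v => by
      have h := ricci_identity_two hG hH hx (e w) (e z) (e u) (e v)
      rw [frameR, frameR, ← hH.bilin_apply hx, ← hH.bilin_apply hx] at h
      simpa [LinearMap.sum_apply] using h
    DDH_trace := fun i j => trace_symm hH _ _
    Φ_eq := fun i j => by rw [hφ x hx, he]
    DDΦ_eq := fun i j k l => hDDφ _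
    DDΦ_trace := fun i j => trace_symm hφT _ _ }

end

/-! ### Charts, transition maps and the metric in charts. -/

section Charts

variable {n k : ℕ} {M : Type*} [TopologicalSpace M] [ChartedSpace (Model n) M]

variable (n) in
/-- The target of the preferred chart at `p`. -/
abbrev chartDomain (p : M) : Set (Model n) := (extChartAt (𝓡 n) p).target

variable (n) in
/-- The transition map from the preferred chart at `p` to the one at `q`. -/
noncomputable def transition (p q : M) : Model n → Model n :=
  extChartAt (𝓡 n) q ∘ (extChartAt (𝓡 n) p).symm

variable (n) in
/-- The domain of the transition map from the preferred chart at `p` to the one at `q`. -/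
def transitionDomain (p q : M) : Set (Model n) :=
  ((extChartAt (𝓡 n) p).symm.trans (extChartAt (𝓡 n) q)).source

variable (n) in
theorem mem_chartDomain (p : M) : extChartAt (𝓡 n) p p ∈ chartDomain n p :=
  mem_extChartAt_target p

theorem mem_transitionDomain {p q : M} {x : Model n} : x ∈ transitionDomain n p q ↔
    x ∈ chartDomain n p ∧ (extChartAt (𝓡 n) p).symm x ∈ (extChartAt (𝓡 n) q).source := by
  rfl

theorem isOpen_chartDomain (p : M) : IsOpen (chartDomain n p) :=
  isOpen_extChartAt_target p

theorem isOpen_transitionDomain (p q : M) : IsOpen (transitionDomain n p q) := by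
  have h : transitionDomain n p q = chartDomain n p ∩
      (extChartAt (𝓡 n) p).symm ⁻¹' (extChartAt (𝓡 n) q).source := by
    ext x; exact mem_transitionDomain
  rw [h]
  exact (continuousOn_extChartAt_symm p).isOpen_inter_preimage (isOpen_chartDomain p)
    (isOpen_extChartAt_source q)

theorem mem_transitionDomain_self {p : M} {x : Model n} (hx : x ∈ chartDomain n p) :
    x ∈ transitionDomain n p ((extChartAt (𝓡 n) p).symm x) :=
  mem_transitionDomain.2 ⟨hx, mem_extChartAt_source _⟩

theorem mapsTo_transition (p q : M) : MapsTo (transition n p q) (transitionDomain n p q)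
    (chartDomain n q) := fun _ hx =>
  (extChartAt (𝓡 n) q).map_source (mem_transitionDomain.1 hx).2

theorem symm_transition {p q : M} {x : Model n} (hx : x ∈ transitionDomain n p q) :
    (extChartAt (𝓡 n) q).symm (transition n p q x) = (extChartAt (𝓡 n) p).symm x :=
  (extChartAt (𝓡 n) q).left_inv (mem_transitionDomain.1 hx).2

/-- All tangent spaces are definitionally the model space, so vectors at equal base points can be
compared there. -/
theorem CovTensor.congr_point (T : CovTensor n k M) {a b : M} (h : a = b)
    {v : Fin k → TangentSpace (𝓡 n) a} {w : Fin k → TangentSpace (𝓡 n) b}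
    (hvw : ∀ i, @Eq (Model n) (v i) (w i)) : T a v = T b w := by
  subst h
  congr 1
  exact funext hvw

variable [IsManifold (𝓡 n) ∞ M]

theorem contDiffOn_transition (p q : M) :
    ContDiffOn ℝ ∞ (transition n p q) (transitionDomain n p q) :=
  contDiffOn_ext_coord_change q p

theorem mdifferentiableAt_symm {p : M} {x : Model n} (hx : x ∈ chartDomain n p) :
    MDifferentiableAt 𝓘(ℝ, Model n) (𝓡 n) (extChartAt (𝓡 n) p).symm x :=
  have : IsManifold (𝓡 n) 1 M := IsManifold.of_le (n := ∞) (by simp)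
  (mdifferentiableOn_extChartAt_symm x hx).mdifferentiableAt ((isOpen_chartDomain p).mem_nhds hx)

/-- The tangent space at `p` is identified with the model space by the preferred chart at `p`
itself. -/
theorem mfderiv_symm_self (p : M) (v : Model n) :
    mfderiv 𝓘(ℝ, Model n) (𝓡 n) (extChartAt (𝓡 n) p).symm (extChartAt (𝓡 n) p p) v = v := by
  have : IsManifold (𝓡 n) 1 M := IsManifold.of_le (n := ∞) (by simp)
  have h := mfderivWithin_range_extChartAt_symm (I := 𝓡 n) (x := p)
  rw [ModelWithCorners.range_eq_univ, mfderivWithin_univ] at h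
  rw [h]
  rfl

theorem mfderiv_symm_transition {p q : M} {x : Model n} (hx : x ∈ transitionDomain n p q)
    (v : Model n) :
    (mfderiv 𝓘(ℝ, Model n) (𝓡 n) (extChartAt (𝓡 n) p).symm x v : Model n) =
      mfderiv 𝓘(ℝ, Model n) (𝓡 n) (extChartAt (𝓡 n) q).symm (transition n p q x)
        (fderiv ℝ (transition n p q) x v) := by
  have hd : DifferentiableAt ℝ (transition n p q) x :=
    ((contDiffOn_transition p q).contDiffAt
      ((isOpen_transitionDomain p q).mem_nhds hx)).differentiableAt (by simp)
  have h1 : (extChartAt (𝓡 n) p).symm =ᶠ[nhds x]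
      (extChartAt (𝓡 n) q).symm ∘ transition n p q :=
    Filter.eventuallyEq_of_mem ((isOpen_transitionDomain p q).mem_nhds hx) fun y hy =>
      (symm_transition hy).symm
  have h2 := mfderiv_comp x (mdifferentiableAt_symm (mapsTo_transition p q hx))
    hd.mdifferentiableAt
  have h3 := h1.mfderiv_eq (I := 𝓘(ℝ, Model n)) (I' := 𝓡 n)
  have h4 := DFunLike.congr_fun h3 v
  refine Eq.trans h4 ?_
  have h5 := DFunLike.congr_fun h2 v
  refine Eq.trans h5 ?_
  rw [mfderiv_eq_fderiv]
  rfl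

theorem inChart_transition (T : CovTensor n k M) {p q : M} {x : Model n}
    (hx : x ∈ transitionDomain n p q) (v : Fin k → Model n) :
    inChart p T x v = inChart q T (transition n p q x)
      fun i => fderiv ℝ (transition n p q) x (v i) :=
  CovTensor.congr_point T (symm_transition hx).symm fun i => mfderiv_symm_transition hx (v i)

theorem inChart_self (T : CovTensor n k M) (p : M) (v : Fin k → Model n) :
    inChart p T (extChartAt (𝓡 n) p p) v = T p v :=
  CovTensor.congr_point T (extChartAt_to_inv p) fun i => mfderiv_symm_self p (v i)

/-- A tensor field which is given at each point by a natural construction in the preferred chart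
is given by this construction in all of this chart. -/
theorem inChart_eq_of_natural (T : CovTensor n k M) (S : M → CoordTensor n k)
    (hT : ∀ q v, T q v = S q (extChartAt (𝓡 n) q q) v)
    (hS : ∀ p q, ∀ x ∈ transitionDomain n p q, ∀ v, S p x v = S q (transition n p q x)
      fun i => fderiv ℝ (transition n p q) x (v i)) {p : M} {x : Model n} (hx : x ∈ chartDomain n p)
    (v : Fin k → Model n) : inChart p T x v = S p x v := by
  -- The second chart is the one preferred at the point with coordinates `x`; there `hT` applies.
  have hx' := mem_transitionDomain_self hx
  rw [inChart_transition T hx', hS _ _ x hx']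
  exact (inChart_self T _ _).trans (hT _ _)

/-! ### The metric in charts -/

variable (g : Metric n M)

theorem injective_mfderiv_symm {p : M} {x : Model n}
    (hx : x ∈ chartDomain n p) (a : Model n)
    (ha : mfderiv 𝓘(ℝ, Model n) (𝓡 n) (extChartAt (𝓡 n) p).symm x a = 0) : a = 0 := by
  have : IsManifold (𝓡 n) 1 M := IsManifold.of_le (n := ∞) (by simp)
  have h := isInvertible_mfderivWithin_extChartAt_symm (I := 𝓡 n) hx
  rw [ModelWithCorners.range_eq_univ, mfderivWithin_univ] at h
  exact h.injective (ha.trans (map_zero _).symm)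

/-- Smoothness of the metric is given for a bundle section, so it must be evaluated on vectors known
to be smooth as maps into the tangent bundle. -/
theorem contMDiffOn_mfderiv_symm (p : M) {X : Type*} [NormedAddCommGroup X] [NormedSpace ℝ X]
    {s : Set X} {b v : X → Model n} (hb : ContDiffOn ℝ ∞ b s) (hv : ContDiffOn ℝ ∞ v s)
    (h : MapsTo b s (chartDomain n p)) :
    ContMDiffOn 𝓘(ℝ, X) (𝓡 n).tangent ∞
      (fun z : X => (TotalSpace.mk' (Model n) ((extChartAt (𝓡 n) p).symm (b z))
        (mfderiv 𝓘(ℝ, Model n) (𝓡 n) (extChartAt (𝓡 n) p).symm (b z) (v z)) :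
          TangentBundle (𝓡 n) M)) s := by
  have h1 := (contMDiffOn_extChartAt_symm (I := 𝓡 n) (n := ∞) p).contMDiffOn_tangentMapWithin
    (m := ∞) (by simp) (isOpen_chartDomain p).uniqueMDiffOn
  have h2 : ContMDiffOn 𝓘(ℝ, X) (𝓘(ℝ, Model n).prod 𝓘(ℝ, Model n)) ∞
      (fun z => ((b z, v z) : ModelProd (Model n) (Model n))) s :=
    hb.contMDiffOn.prodMk hv.contMDiffOn
  have h3 : ContMDiffOn 𝓘(ℝ, X) 𝓘(ℝ, Model n).tangent ∞
      (fun z => (⟨b z, v z⟩ : TangentBundle 𝓘(ℝ, Model n) (Model n))) s := by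
    have h0 := contMDiff_tangentBundleModelSpaceHomeomorph_symm (I := 𝓘(ℝ, Model n)) (n := ∞)
    rw [chartedSpaceSelf_prod] at h2
    exact h0.comp_contMDiffOn h2
  refine (h1.comp h3 fun z hz => h hz).congr fun z hz => ?_
  simp only [comp_apply, tangentMapWithin]
  rw [mfderivWithin_of_isOpen (isOpen_chartDomain p) (h hz)]

theorem contDiffOn_inner_mfderiv_symm (p : M) {X : Type*} [NormedAddCommGroup X]
    [NormedSpace ℝ X] {s : Set X} {b v w : X → Model n} (hb : ContDiffOn ℝ ∞ b s)
    (hv : ContDiffOn ℝ ∞ v s) (hw : ContDiffOn ℝ ∞ w s) (h : MapsTo b s (chartDomain n p)) :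
    ContDiffOn ℝ ∞ (fun z => g.inner ((extChartAt (𝓡 n) p).symm (b z))
      (mfderiv 𝓘(ℝ, Model n) (𝓡 n) (extChartAt (𝓡 n) p).symm (b z) (v z))
      (mfderiv 𝓘(ℝ, Model n) (𝓡 n) (extChartAt (𝓡 n) p).symm (b z) (w z))) s := by
  have hb' : ContMDiffOn 𝓘(ℝ, X) (𝓡 n) ∞ (fun z => (extChartAt (𝓡 n) p).symm (b z)) s :=
    (contMDiffOn_extChartAt_symm p).comp hb.contMDiffOn h
  rw [← contMDiffOn_iff_contDiffOn]
  intro z hz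
  have : ContMDiffWithinAt 𝓘(ℝ, X) ((𝓡 n).prod 𝓘(ℝ)) ∞ (fun z => TotalSpace.mk' ℝ
      (E := Bundle.Trivial M ℝ) ((extChartAt (𝓡 n) p).symm (b z))
      (g.inner ((extChartAt (𝓡 n) p).symm (b z))
      (mfderiv 𝓘(ℝ, Model n) (𝓡 n) (extChartAt (𝓡 n) p).symm (b z) (v z))
      (mfderiv 𝓘(ℝ, Model n) (𝓡 n) (extChartAt (𝓡 n) p).symm (b z) (w z)))) s z := by
    apply ContMDiffWithinAt.clm_bundle_apply₂ (F₁ := Model n) (F₂ := Model n)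
    · exact ContMDiffAt.comp_contMDiffWithinAt z g.contMDiff.contMDiffAt (hb' z hz)
    · exact contMDiffOn_mfderiv_symm p hb hv h z hz
    · exact contMDiffOn_mfderiv_symm p hb hw h z hz
  simp only [contMDiffWithinAt_totalSpace] at this
  exact this.2

theorem isMetricOn_inChart (p : M) :
    IsMetricOn (chartDomain n p) (inChart p (metricTensor g)) where
  isOpen := isOpen_chartDomain p
  symm x _ a b := g.symm _ _ _
  pos x hx a ha := g.pos _ _ fun h => ha (injective_mfderiv_symm hx a h)
  tensor := by
    refine IsTensorOn.of_update (fun x hx v i c a b => ?_) ?_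
    · set q := (extChartAt (𝓡 n) p).symm x
      set L := mfderiv 𝓘(ℝ, Model n) (𝓡 n) (extChartAt (𝓡 n) p).symm x
      have hL : ∀ a b : TangentSpace 𝓘(ℝ, Model n) x, L (c • a + b) = c • L a + L b :=
        fun a b => by rw [map_add, map_smul]
      have hl : ∀ u v w : TangentSpace (𝓡 n) q,
          g.inner q (c • u + v) w = c • g.inner q u w + g.inner q v w := fun u v w => by simp
      have hr : ∀ u v w : TangentSpace (𝓡 n) q,
          g.inner q w (c • u + v) = c • g.inner q w u + g.inner q w v := fun u v w => by simp
      fin_cases i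
      · exact (congrArg (fun z => g.inner q z (L (v 1))) (hL a b)).trans (hl _ _ _)
      · exact (congrArg (fun z => g.inner q (L (v 0)) z) (hL a b)).trans (hr _ _ _)
    · exact contDiffOn_inner_mfderiv_symm g p contDiffOn_fst (ContDiff.contDiffOn (by fun_prop))
        (ContDiff.contDiffOn (by fun_prop)) fun z hz => hz.1

theorem isTensorOn_inChart_ofFun {f : M → ℝ} (hf : ContMDiff (𝓡 n) 𝓘(ℝ, ℝ) ∞ f) (p : M) :
    IsTensorOn (chartDomain n p) (inChart p (ofFun f)) := by
  refine IsTensorOn.of_update (fun x hx v i => i.elim0) ?_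
  have : ContDiffOn ℝ ∞ (fun x => f ((extChartAt (𝓡 n) p).symm x)) (chartDomain n p) :=
    contMDiffOn_iff_contDiffOn.1
      (hf.comp_contMDiffOn (contMDiffOn_extChartAt_symm (I := 𝓡 n) (n := ∞) p))
  exact this.comp contDiffOn_fst fun z hz => hz.1

end Charts

/-! ### Naturality of curvature and bilinear maps from two slots. -/

section

variable {n k : ℕ} {U V : Set (Model n)} {G G' : CoordTensor n 2} {φ : Model n → Model n}
  {x : Model n}

theorem IsIsometryOn.curvTensor (h : IsIsometryOn φ V U G' G) (hx : x ∈ V)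
    (v : Fin 4 → Model n) :
    curvTensor G' x v = curvTensor G (φ x) fun i => fderiv ℝ φ x (v i) := by
  unfold RicciDrift.curvTensor
  rw [h.pullback_pair hx, h.coordCurvOp hx]

theorem IsIsometryOn.ricciTensor (h : IsIsometryOn φ V U G' G) (hx : x ∈ V)
    (v : Fin 2 → Model n) :
    ricciTensor G' x v = ricciTensor G (φ x) fun i => fderiv ℝ φ x (v i) :=
  h.contr (h.target.curvTensor.perm _) (h.source.curvTensor.perm _)
    (fun _ hy v => h.curvTensor hy fun i => v (Equiv.swap 1 2 i)) hx v

theorem update_snoc_snoc {E : Type*} (v : Fin k → E) (a b c d : E) :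
    update (update (Fin.snoc (Fin.snoc v c : Fin (k + 1) → E) d : Fin (k + 2) → E)
      (Fin.last k).castSucc a) (Fin.last (k + 1)) b =
      (Fin.snoc (Fin.snoc v a : Fin (k + 1) → E) b : Fin (k + 2) → E) := by
  rw [← Fin.snoc_update, Fin.update_snoc_last, Fin.update_snoc_last]

/-- Two slots of a tensor field, as a bilinear map. -/
noncomputable def IsTensorOn.bilinSlots {T : CoordTensor n k} (hT : IsTensorOn U T) (hx : x ∈ U)
    (v : Fin k → Model n) {i j : Fin k} (hij : i ≠ j) : Model n →ₗ[ℝ] Model n →ₗ[ℝ] ℝ :=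
  LinearMap.mk₂ ℝ (fun a b => T x (update (update v i a) j b))
    (fun a b c => by
      simp only [update_comm hij, ← slot_apply hT hx, map_add])
    (fun r a c => by
      simp only [update_comm hij, ← slot_apply hT hx, map_smul])
    (fun a b c => by
      simp only [← slot_apply hT hx, map_add])
    (fun r a c => by
      simp only [← slot_apply hT hx, map_smul])

theorem IsTensorOn.bilinSlots_apply {T : CoordTensor n k} (hT : IsTensorOn U T) (hx : x ∈ U)
    (v : Fin k → Model n) {i j : Fin k} (hij : i ≠ j) (a b : Model n) :
    hT.bilinSlots hx v hij a b = T x (update (update v i a) j b) := rfl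

end

/-! ### Tensor fields on the manifold computed in a single chart, and traces in frames. -/

section Manifold

variable {n k : ℕ} {M : Type*} [TopologicalSpace M] [ChartedSpace (Model n) M]
  [IsManifold (𝓡 n) ∞ M] (g : Metric n M)

/-- The transition maps are isometries for the metric in the charts. -/
theorem isIsometryOn_transition (p q : M) : IsIsometryOn (transition n p q)
    (transitionDomain n p q) (chartDomain n q) (inChart p (metricTensor g))
    (inChart q (metricTensor g)) where
  source :=
    { isOpen := isOpen_transitionDomain p q
      tensor := (isMetricOn_inChart g p).tensor.mono fun _ hx => (mem_transitionDomain.1 hx).1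
      symm := fun x hx => (isMetricOn_inChart g p).symm x (mem_transitionDomain.1 hx).1
      pos := fun x hx => (isMetricOn_inChart g p).pos x (mem_transitionDomain.1 hx).1 }
  target := isMetricOn_inChart g q
  mapsTo := mapsTo_transition p q
  smooth := contDiffOn_transition p q
  pullback _ hx v := inChart_transition _ hx v

/-- A tensor field on `M` which is smooth in all preferred charts. -/
def IsSmoothTensor (T : CovTensor n k M) : Prop :=
  ∀ p, IsTensorOn (chartDomain n p) (inChart p T)

theorem inChart_metricTensor_self (p : M) (a b : Model n) :
    inChart p (metricTensor g) (extChartAt (𝓡 n) p p) ![a, b] = g.inner p a b :=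
  inChart_self _ _ _

/-- By definition the value at each point is computed in the chart of that point. Naturality under
the isometric transition maps replaces these by one chart, which is what a further differentiation
requires. -/
theorem inChart_covDeriv {T : CovTensor n k M} (hT : IsSmoothTensor T) {p : M} {x : Model n}
    (hx : x ∈ chartDomain n p) : inChart p (covDeriv g T) x =
      coordCovDeriv (inChart p (metricTensor g)) (inChart p T) x :=
  funext fun v => inChart_eq_of_natural (covDeriv g T)
    (fun q => coordCovDeriv (inChart q (metricTensor g)) (inChart q T)) (fun _ _ => rfl)
    (fun p q _ hy v => (isIsometryOn_transition g p q).coordCovDeriv (hT q)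
      (fun _ hz w => inChart_transition T hz w) hy v) hx v

theorem IsSmoothTensor.covDeriv {T : CovTensor n k M} (hT : IsSmoothTensor T) :
    IsSmoothTensor (covDeriv g T) := fun p =>
  ((hT p).coordCovDeriv (isMetricOn_inChart g p)).congr fun _ hx => inChart_covDeriv g hT hx

theorem riemann_apply (p : M) (v : Fin 4 → TangentSpace (𝓡 n) p) :
    riemann g p v = curvTensor (inChart p (metricTensor g)) (extChartAt (𝓡 n) p p) v :=
  (inChart_metricTensor_self g p _ _).symm

theorem invGram_eq (p : M) : invGram (fun a b : Model n => g.inner p a b) =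
    invGram fun a b => inChart p (metricTensor g) (extChartAt (𝓡 n) p p) ![a, b] := by
  simp only [inChart_metricTensor_self]

theorem ricci_apply (p : M) (v : Fin 2 → TangentSpace (𝓡 n) p) :
    ricci g p v = ricciTensor (inChart p (metricTensor g)) (extChartAt (𝓡 n) p p) v := by
  unfold ricci traceAt ricciTensor contr
  rw [invGram_eq]
  refine Finset.sum_congr rfl fun i _ => Finset.sum_congr rfl fun j _ => ?_
  refine congrArg (_ * ·) ((riemann_apply g p _).trans (congrArg _ ?_))
  ext l : 1
  fin_cases l <;> rfl

theorem inChart_ricci {p : M} {x : Model n} (hx : x ∈ chartDomain n p) :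
    inChart p (ricci g) x = ricciTensor (inChart p (metricTensor g)) x :=
  funext fun v => inChart_eq_of_natural (ricci g)
    (fun q => ricciTensor (inChart q (metricTensor g))) (fun _ _ => ricci_apply g _ _)
    (fun p q _ hy v => (isIsometryOn_transition g p q).ricciTensor hy v) hx v

theorem isSmoothTensor_ricci : IsSmoothTensor (ricci g) := fun p =>
  (isMetricOn_inChart g p).ricciTensor.congr fun _ hx => inChart_ricci g hx

theorem inChart_ofFun_trace {T : CovTensor n 2 M} (hT : IsSmoothTensor T) {p : M} {x : Model n}
    (hx : x ∈ chartDomain n p) : inChart p (ofFun (trace g T)) x =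
      contr (k := 0) (inChart p (metricTensor g)) (inChart p T) x := by
  refine funext fun v => inChart_eq_of_natural (ofFun (trace g T))
    (fun q => contr (k := 0) (inChart q (metricTensor g)) (inChart q T)) (fun q v => ?_)
    (fun p q y hy v => ?_) hx v
  · unfold ofFun trace traceAt contr
    rw [invGram_eq]
    refine Finset.sum_congr rfl fun i _ => Finset.sum_congr rfl fun j _ => ?_
    rw [inChart_self]
    refine congrArg _ (congrArg _ ?_)
    ext l : 1
    fin_cases l <;> rfl
  · exact (isIsometryOn_transition g p q).contr (hT q)
      ((hT p).mono fun _ hx => (mem_transitionDomain.1 hx).1)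
      (fun _ hz w => inChart_transition T hz w) hy v

theorem isSmoothTensor_ofFun_trace {T : CovTensor n 2 M} (hT : IsSmoothTensor T) :
    IsSmoothTensor (n := n) (ofFun (trace g T)) := fun p =>
  ((hT p).contr (k := 0) (isMetricOn_inChart g p)).congr fun _ hx => inChart_ofFun_trace g hT hx

theorem covDeriv_covDeriv_apply {T : CovTensor n k M} (hT : IsSmoothTensor T) (p : M)
    (v : Fin (k + 2) → TangentSpace (𝓡 n) p) :
    covDeriv g (covDeriv g T) p v = coordCovDeriv (inChart p (metricTensor g))
      (coordCovDeriv (inChart p (metricTensor g)) (inChart p T)) (extChartAt (𝓡 n) p p) v :=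
  congrFun (coordCovDeriv_congr (isOpen_chartDomain (n := n) p) (fun _ _ => rfl)
    (fun _ hy => inChart_covDeriv g hT hy) (mem_chartDomain n p)) v

section Frame

variable {p : M} {e : Fin n → TangentSpace (𝓡 n) p}

theorem inChart_orthonormal (he : ∀ i j, g.inner p (e i) (e j) = if i = j then 1 else 0)
    (i j : Fin n) : inChart p (metricTensor g) (extChartAt (𝓡 n) p p) ![e i, e j] =
      if i = j then 1 else 0 := by
  rw [← he]
  exact inChart_metricTensor_self g p _ _

/-- `C` certifies that `B` is bilinear, which its type does not record. -/
theorem traceAt_eq_sum (he : ∀ i j, g.inner p (e i) (e j) = if i = j then 1 else 0)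
    {B : TangentSpace (𝓡 n) p → TangentSpace (𝓡 n) p → ℝ}
    (C : Model n →ₗ[ℝ] Model n →ₗ[ℝ] ℝ) (h : ∀ a b : Model n, B a b = C a b) :
    traceAt g p B = ∑ i, B (e i) (e i) := by
  have hG := isMetricOn_inChart g p
  have hx := mem_chartDomain n p
  unfold traceAt
  rw [invGram_eq]
  refine (Finset.sum_congr rfl fun i _ => Finset.sum_congr rfl fun j _ =>
    congrArg _ (h _ _)).trans ?_
  refine (sum_invGram_mul C _).trans ?_
  refine (sum_dualVec_eq (B := hG.tensor.bilin hx) (hG.symm _ hx) (hG.pos _ hx)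
    (sum_orthonormal (B := hG.tensor.bilin hx) (e := e)
      (inChart_orthonormal (n := n) (p := p) (e := e) g he)) C).trans ?_
  exact Finset.sum_congr rfl fun i _ => (h _ _).symm

theorem grad_eq_sum (he : ∀ i j, g.inner p (e i) (e j) = if i = j then 1 else 0) {f : M → ℝ}
    (hf : IsSmoothTensor (n := n) (ofFun f)) :
    grad g f p = ∑ m, covDeriv g (ofFun f) p ![e m] • e m := by
  have hG := isMetricOn_inChart g p
  have hx := mem_chartDomain n p
  have hdf := (hf p).coordCovDeriv hG
  have h1 : @Eq (Model n) (grad g f p) (∑ j, coordCovDeriv (inChart p (metricTensor g))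
      (inChart p (ofFun f)) (extChartAt (𝓡 n) p p) ![coordVec j] •
        dualVec (fun a b => inChart p (metricTensor g) (extChartAt (𝓡 n) p p) ![a, b]) j) := by
    unfold grad
    rw [invGram_eq]
    refine PiLp.ext fun i => ?_
    simp only [dualVec, WithLp.ofLp_sum, Finset.sum_apply, WithLp.ofLp_smul, Pi.smul_apply,
      smul_eq_mul]
    exact Finset.sum_congr rfl fun j _ => mul_comm _ _
  -- The gradient represents the differential, so its frame coefficients are the values of the
  -- differential on the frame.
  have h2 : ∀ w : Model n, inChart p (metricTensor g) (extChartAt (𝓡 n) p p) ![grad g f p, w] =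
      coordCovDeriv (inChart p (metricTensor g)) (inChart p (ofFun f)) (extChartAt (𝓡 n) p p)
        ![w] := by
    intro w
    rw [h1, ← hG.tensor.bilin_apply hx]
    simp only [map_sum, map_smul, LinearMap.sum_apply, LinearMap.smul_apply,
      IsTensorOn.bilin_apply, hG.dualVec_left hx, smul_eq_mul]
    conv_rhs => rw [← sum_coordVec w, ← hdf.lin_apply hx]
    simp [mul_comm]
  have h3 := IsMetricOn.sum_inner_smul (e := e)
    (inChart_orthonormal (n := n) (p := p) (e := e) g he) hG hx (grad g f p)
  refine h3.symm.trans (Finset.sum_congr rfl fun m _ => ?_)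
  exact congrArg (fun c : ℝ => c • (e m : Model n)) (h2 _)

theorem driftLaplacian_eq_sum (he : ∀ i j, g.inner p (e i) (e j) = if i = j then 1 else 0)
    {f : M → ℝ} (hf : IsSmoothTensor (n := n) (ofFun f)) {T : CovTensor n k M}
    (hT : IsSmoothTensor T)
    (v : Fin k → TangentSpace (𝓡 n) p) :
    laplacian g T p v = ∑ i, covDeriv g (covDeriv g T) p (Fin.snoc (Fin.snoc v (e i)) (e i)) ∧
    covDeriv g T p (Fin.snoc v (grad g f p)) =
      ∑ m, covDeriv g T p (Fin.snoc v (e m)) * covDeriv g (ofFun f) p ![e m] := by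
  have hG := isMetricOn_inChart g p
  have hx := mem_chartDomain n p
  have hDT := (hT p).coordCovDeriv hG
  have hDDT := hDT.coordCovDeriv hG
  constructor
  · refine traceAt_eq_sum g he (hDDT.bilinSlots hx (Fin.snoc (Fin.snoc v 0) 0)
      (i := (Fin.last k).castSucc) (j := Fin.last (k + 1)) (Fin.castSucc_lt_last _).ne)
      fun a b => ?_
    refine (covDeriv_covDeriv_apply g hT p _).trans (Eq.trans ?_
      (IsTensorOn.bilinSlots_apply hDDT hx _ _ a b).symm)
    exact congrArg _ (update_snoc_snoc _ _ _ _ _).symm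
  · rw [grad_eq_sum g he hf]
    have h1 : ∀ a : Model n, covDeriv g T p (Fin.snoc v a) =
        hDT.slot hx (Fin.snoc v 0) (Fin.last k) a := fun a =>
      Eq.trans (congrArg _ (Fin.update_snoc_last ..).symm) (IsTensorOn.slot_apply hDT hx _ _ _).symm
    refine (h1 _).trans ?_
    refine (map_sum (hDT.slot hx (Fin.snoc v 0) (Fin.last k)) _ _).trans ?_
    refine Finset.sum_congr rfl fun m _ => ?_
    refine ((hDT.slot hx (Fin.snoc v 0) (Fin.last k)).map_smul _ _).trans ?_
    exact (mul_comm _ _).trans (congrArg (· * _) (h1 (e m)).symm)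

/-- The nested traces are evaluated from the inside out, each with its own certificate of
bilinearity. -/
theorem opL_eq_sum (he : ∀ i j, g.inner p (e i) (e j) = if i = j then 1 else 0)
    {f : M → ℝ} {B : CovTensor n 2 M} (hB : IsSmoothTensor B) (v : Fin 2 → TangentSpace (𝓡 n) p) :
    opL g f B p v = driftLaplacian g f B p v +
      2 * ∑ l, ∑ k, riemann g p ![e l, v 0, e k, v 1] * B p ![e l, e k] := by
  have hG := isMetricOn_inChart g p
  have hx := mem_chartDomain n p
  have hR := hG.curvTensor
  set x := extChartAt (𝓡 n) p p
  set R := curvTensor (inChart p (metricTensor g))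
  set v0 : Model n := v 0
  set v1 : Model n := v 1
  set e' : Fin n → Model n := e
  have hval : ∀ a b a' b' : Model n, riemann g p ![a, v 0, b, v 1] * B p ![a', b'] =
      R x ![a, v0, b, v1] * inChart p B x ![a', b'] := fun a b a' b' =>
    congrArg₂ (· * ·) (riemann_apply g p _) (inChart_self B p _).symm
  have h0 : ∀ a a' : Model n, (traceAt g p fun b b' => riemann g p ![a, v 0, b, v 1] *
      B p ![a', b']) = ∑ k, riemann g p ![a, v 0, e k, v 1] * B p ![a', e k] := by
    intro a a'
    refine traceAt_eq_sum g he ((LinearMap.mul ℝ ℝ).compl₁₂ (hR.slot hx ![a, v0, 0, v1] 2)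
      ((hB p).slot hx ![a', 0] 1)) fun b b' => (hval a b a' b').trans ?_
    rw [LinearMap.compl₁₂_apply, IsTensorOn.slot_apply, IsTensorOn.slot_apply, update_vec4_two,
      update_vec2_one]
    rfl
  unfold opL
  congr 2
  refine (congrArg (traceAt g p) (funext fun a => funext fun a' => h0 a a')).trans ?_
  refine traceAt_eq_sum g he (∑ k, (LinearMap.mul ℝ ℝ).compl₁₂ (hR.slot hx ![0, v0, e' k, v1] 0)
      ((hB p).slot hx ![0, e' k] 0)) fun a a' => ?_
  simp only [LinearMap.sum_apply]
  refine Finset.sum_congr rfl fun k _ => (hval a (e' k) a' (e' k)).trans ?_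
  rw [LinearMap.compl₁₂_apply, IsTensorOn.slot_apply, IsTensorOn.slot_apply, update_vec4_zero,
    update_vec2_zero]
  rfl

end Frame

end Manifold

/-! ### Component relations and traces for `φ` and `Ric` on the manifold. -/

section Soliton

variable {n : ℕ} {M : Type*} [TopologicalSpace M] [ChartedSpace (Model n) M]
  [IsManifold (𝓡 n) ∞ M] (g : Metric n M) {p : M} {e : Fin n → TangentSpace (𝓡 n) p}
  {f : M → ℝ} {κ : ℝ}

theorem inChart_solitonDefect (hf : IsSmoothTensor (n := n) (ofFun f)) (κ : ℝ) {x : Model n}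
    (hx : x ∈ chartDomain n p) (v : Fin 2 → Model n) : inChart p (solitonDefect g f κ) x v =
      κ * inChart p (metricTensor g) x v - ricciTensor (inChart p (metricTensor g)) x v -
        coordCovDeriv (inChart p (metricTensor g)) (coordCovDeriv (inChart p (metricTensor g))
          (inChart p (ofFun f))) x v := by
  rw [← inChart_ricci g hx, ← coordCovDeriv_congr (isOpen_chartDomain (n := n) p) (fun _ _ => rfl)
    (fun _ hy => inChart_covDeriv g hf hy) hx, ← inChart_covDeriv g (hf.covDeriv g) hx]
  rfl

theorem isSmoothTensor_solitonDefect (hf : IsSmoothTensor (n := n) (ofFun f)) (κ : ℝ) :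
    IsSmoothTensor (solitonDefect g f κ) := fun p =>
  have hG := isMetricOn_inChart g p
  (((hG.tensor.const_smul κ).sub hG.ricciTensor).sub
    (((hf p).coordCovDeriv hG).coordCovDeriv hG)).congr
      fun _ hy => funext fun v => inChart_solitonDefect g hf κ hy v

theorem covDeriv_ricci_apply (p : M) (v : Fin 3 → TangentSpace (𝓡 n) p) :
    covDeriv g (ricci g) p v = coordCovDeriv (inChart p (metricTensor g))
      (ricciTensor (inChart p (metricTensor g))) (extChartAt (𝓡 n) p p) v :=
  congrFun (coordCovDeriv_congr (isOpen_chartDomain (n := n) p) (fun _ _ => rfl)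
    (fun _ hy => inChart_ricci g hy) (mem_chartDomain n p)) v

theorem covDeriv_covDeriv_ricci_apply (p : M) (v : Fin 4 → TangentSpace (𝓡 n) p) :
    covDeriv g (covDeriv g (ricci g)) p v = coordCovDeriv (inChart p (metricTensor g))
      (coordCovDeriv (inChart p (metricTensor g)) (ricciTensor (inChart p (metricTensor g))))
        (extChartAt (𝓡 n) p p) v :=
  (covDeriv_covDeriv_apply g (isSmoothTensor_ricci g) p v).trans <|
    congrFun (coordCovDeriv_congr (isOpen_chartDomain (n := n) p) (fun _ _ => rfl)
      (fun _ hy => coordCovDeriv_congr (isOpen_chartDomain (n := n) p) (fun _ _ => rfl)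
        (fun _ hz => inChart_ricci g hz) hy) (mem_chartDomain n p)) v

/-- The derivatives of curvature and the Hessian terms stay existential because the two final
identities do not mention them. -/
theorem exists_solitonComponents
    (he : ∀ i j, g.inner p (e i) (e j) = if i = j then 1 else 0)
    (hf : IsSmoothTensor (n := n) (ofFun f)) (κ : ℝ) :
    ∃ DR DDR H DDH, SolitonComponents κ (fun m => covDeriv g (ofFun f) p ![e m])
      (fun a b c d => riemann g p ![e a, e b, e c, e d]) DR DDR
      (fun a b => ricci g p ![e a, e b])
      (fun a b m => covDeriv g (ricci g) p ![e a, e b, e m])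
      (fun a b l m => covDeriv g (covDeriv g (ricci g)) p ![e a, e b, e l, e m]) H DDH
      (fun a b => solitonDefect g f κ p ![e a, e b])
      (fun a b l m => covDeriv g (covDeriv g (solitonDefect g f κ)) p
        ![e a, e b, e l, e m]) := by
  have h := solitonComponents (e := e) (inChart_orthonormal g he) (isMetricOn_inChart g p) (hf p)
    (fun y hy v => inChart_solitonDefect g hf κ hy v) (mem_chartDomain n p)
  have h1 : (fun a b c d => riemann g p ![e a, e b, e c, e d]) = _ :=
    funext fun a => funext fun b => funext fun c => funext fun d => riemann_apply g p _
  have h2 : (fun a b => ricci g p ![e a, e b]) = _ :=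
    funext fun a => funext fun b => ricci_apply g p _
  have h3 : (fun a b m => covDeriv g (ricci g) p ![e a, e b, e m]) = _ :=
    funext fun a => funext fun b => funext fun m => covDeriv_ricci_apply g p _
  have h4 : (fun a b l m => covDeriv g (covDeriv g (ricci g)) p ![e a, e b, e l, e m]) = _ :=
    funext fun a => funext fun b => funext fun l => funext fun m =>
      covDeriv_covDeriv_ricci_apply g p _
  have h5 : (fun a b => solitonDefect g f κ p ![e a, e b]) = _ :=
    funext fun a => funext fun b => (inChart_self (solitonDefect g f κ) p _).symm
  have h6 : (fun a b l m => covDeriv g (covDeriv g (solitonDefect g f κ)) p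
      ![e a, e b, e l, e m]) = _ :=
    funext fun a => funext fun b => funext fun l => funext fun m =>
      covDeriv_covDeriv_apply g (isSmoothTensor_solitonDefect g hf κ) p _
  rw [h1, h2, h3, h4, h5, h6]
  exact ⟨_, _, _, _, h⟩

theorem trace_eq_sum (he : ∀ i j, g.inner p (e i) (e j) = if i = j then 1 else 0)
    {T : CovTensor n 2 M} (hT : IsSmoothTensor T) : trace g T p = ∑ i, T p ![e i, e i] := by
  refine traceAt_eq_sum g he ((hT p).bilin (mem_chartDomain n p)) fun a b => ?_
  rw [IsTensorOn.bilin_apply]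
  exact (inChart_self T p _).symm

theorem covDeriv_ofFun_trace (he : ∀ i j, g.inner p (e i) (e j) = if i = j then 1 else 0)
    {T : CovTensor n 2 M} (hT : IsSmoothTensor T) (a : TangentSpace (𝓡 n) p) :
    covDeriv g (ofFun (trace g T)) p ![a] = ∑ i, covDeriv g T p ![e i, e i, a] := by
  have hG := isMetricOn_inChart g p
  have hx := mem_chartDomain n p
  refine (congrFun (coordCovDeriv_congr (isOpen_chartDomain (n := n) p) (fun _ _ => rfl)
    (fun _ hy => inChart_ofFun_trace g hT hy) hx) _).trans ?_
  refine (congrArg _ (?_ : (![a] : Fin 1 → Model n) = Fin.snoc ![] a)).trans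
    ((coordCovDeriv_contr hG (hT p) hx _ _).trans <|
      (contr_eq_sum_orthonormal (e := e) hG ((hT p).coordCovDeriv hG) hx
        (inChart_orthonormal g he) _).trans (Finset.sum_congr rfl fun i _ => congrArg _ ?_))
  · ext i : 1; fin_cases i; rfl
  · ext i : 1; fin_cases i <;> rfl

theorem covDeriv_covDeriv_ofFun_trace
    (he : ∀ i j, g.inner p (e i) (e j) = if i = j then 1 else 0)
    {T : CovTensor n 2 M} (hT : IsSmoothTensor T) (a b : TangentSpace (𝓡 n) p) :
    covDeriv g (covDeriv g (ofFun (trace g T))) p ![a, b] =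
      ∑ i, covDeriv g (covDeriv g T) p ![e i, e i, a, b] := by
  have hU := isOpen_chartDomain (n := n) p
  have hx := mem_chartDomain n p
  refine (covDeriv_covDeriv_apply g (isSmoothTensor_ofFun_trace g hT) p _).trans ?_
  refine (congrFun (coordCovDeriv_congr hU (fun _ _ => rfl) (fun _ hy => coordCovDeriv_congr hU
    (fun _ _ => rfl) (fun _ hz => inChart_ofFun_trace g hT hz) hy) hx) _).trans ?_
  refine (sum_coordCovDeriv_coordCovDeriv_eq (e := e) (inChart_orthonormal g he)
    (isMetricOn_inChart g p) (hT p) hx a b).symm.trans (Finset.sum_congr rfl fun i _ => ?_)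
  exact (covDeriv_covDeriv_apply g hT p _).symm

theorem laplacian_ofFun_trace
    (he : ∀ i j, g.inner p (e i) (e j) = if i = j then 1 else 0)
    (hf : IsSmoothTensor (n := n) (ofFun f)) {T : CovTensor n 2 M} (hT : IsSmoothTensor T) :
    laplacian g (ofFun (trace g T)) p ![] =
      ∑ k, ∑ i, covDeriv g (covDeriv g T) p ![e i, e i, e k, e k] := by
  refine (driftLaplacian_eq_sum g he hf (isSmoothTensor_ofFun_trace g hT) ![]).1.trans
    (Finset.sum_congr rfl fun k _ => Eq.trans (congrArg _ ?_)
      (covDeriv_covDeriv_ofFun_trace g he hT _ _))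
  ext i : 1; fin_cases i <;> rfl

theorem driftLaplacian_ofFun_trace
    (he : ∀ i j, g.inner p (e i) (e j) = if i = j then 1 else 0)
    (hf : IsSmoothTensor (n := n) (ofFun f)) {T : CovTensor n 2 M} (hT : IsSmoothTensor T) :
    driftLaplacian g f (ofFun (trace g T)) p ![] =
      ∑ k, ∑ i, covDeriv g (covDeriv g T) p ![e i, e i, e k, e k] -
        ∑ m, (∑ i, covDeriv g T p ![e i, e i, e m]) * covDeriv g (ofFun f) p ![e m] := by
  refine congrArg₂ (· - ·) (laplacian_ofFun_trace g he hf hT)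
    ((driftLaplacian_eq_sum g he hf (isSmoothTensor_ofFun_trace g hT) ![]).2.trans
      (Finset.sum_congr rfl fun m _ => congrArg (· * _) (Eq.trans (congrArg _ ?_)
        (covDeriv_ofFun_trace g he hT _))))
  ext i : 1; fin_cases i; rfl

theorem driftLaplacian_two_eq_sum
    (he : ∀ i j, g.inner p (e i) (e j) = if i = j then 1 else 0)
    (hf : IsSmoothTensor (n := n) (ofFun f)) {T : CovTensor n 2 M} (hT : IsSmoothTensor T)
    (a b : TangentSpace (𝓡 n) p) :
    driftLaplacian g f T p ![a, b] = ∑ k, covDeriv g (covDeriv g T) p ![a, b, e k, e k] -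
      ∑ m, covDeriv g T p ![a, b, e m] * covDeriv g (ofFun f) p ![e m] := by
  have h := driftLaplacian_eq_sum g he hf hT ![a, b]
  refine congrArg₂ (· - ·) (h.1.trans (Finset.sum_congr rfl fun k _ => congrArg _ ?_))
    (h.2.trans (Finset.sum_congr rfl fun m _ => congrArg (· * _) (congrArg _ ?_)))
  · ext i : 1; fin_cases i <;> rfl
  · ext i : 1; fin_cases i <;> rfl

end Soliton

end RicciDrift

/-! ### The evolution identities. -/

theorem theorem2 {n : ℕ} {M : Type*} [TopologicalSpace M]
    [ChartedSpace (EuclideanSpace ℝ (Fin n)) M] [IsManifold (𝓡 n) ∞ M]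
    (g : ContMDiffRiemannianMetric (𝓡 n) ∞ (EuclideanSpace ℝ (Fin n))
      (fun p : M => TangentSpace (𝓡 n) p))
    (f : M → ℝ) (hf : ContMDiff (𝓡 n) 𝓘(ℝ, ℝ) ∞ f) (κ : ℝ)
    (φ : CovTensor n 2 M) (hφ : φ = solitonDefect g f κ)
    (p : M) (e : Fin n → TangentSpace (𝓡 n) p)
    (he : ∀ i j, g.inner p (e i) (e j) = if i = j then 1 else 0) :
    (∀ i j : Fin n,
      opL g f (ricci g) p ![e i, e j] =
        2 * κ * ricci g p ![e i, e j]
          + 2 * ∑ k, ∑ m, riemann g p ![e k, e j, e i, e m] * φ p ![e m, e k]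
          - ∑ k, covDeriv g (covDeriv g φ) p ![e i, e j, e k, e k]
          - ∑ k, covDeriv g (covDeriv g φ) p ![e k, e k, e j, e i]
          + ∑ k, covDeriv g (covDeriv g φ) p ![e j, e k, e k, e i]
          + ∑ k, covDeriv g (covDeriv g φ) p ![e i, e k, e k, e j]) ∧
    driftLaplacian g f (ofFun (scalarCurv g)) p ![] =
      2 * κ * scalarCurv g p
        - 2 * ∑ k, ∑ m, ricci g p ![e k, e m] ^ 2
        - 2 * ∑ k, ∑ m, ricci g p ![e k, e m] * φ p ![e m, e k]
        - 2 * laplacian g (ofFun (trace g φ)) p ![]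
        + 2 * ∑ i, ∑ k, covDeriv g (covDeriv g φ) p ![e i, e k, e k, e i] := by
  subst hφ
  have hF : IsSmoothTensor (n := n) (ofFun f) := isTensorOn_inChart_ofFun hf
  obtain ⟨DR, DDR, H, DDH, h⟩ := exists_solitonComponents g he hF κ
  constructor
  · intro i j
    rw [opL_eq_sum g he (isSmoothTensor_ricci g),
      driftLaplacian_two_eq_sum g he hF (isSmoothTensor_ricci g)]
    exact h.ricci_evolution i j
  -- Traces are moved outside the derivatives on both sides, which gives the double sums of
  -- `scalar_evolution`.
  · rw [laplacian_ofFun_trace g he hF (isSmoothTensor_solitonDefect g hF κ)]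
    unfold scalarCurv
    rw [driftLaplacian_ofFun_trace g he hF (isSmoothTensor_ricci g),
      trace_eq_sum g he (isSmoothTensor_ricci g)]
    exact h.scalar_evolution
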